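/- Let $1<r\le p<\infty$ and $1<q<\infty$, and write $s'=s/(s-1)$. Let $\sigma,w$ be weights on $\mathbb R^d$ (locally integrable, positive a.e.; $\sigma(Q)=\int_Q\sigma$, $w(Q)=\int_Q w$), let $\mathcal D$ be a dyadic grid in $\mathbb R^d$, $\mathcal Q\subseteq\mathcal D$ any collection of its cubes, and $\tau=\{\tau_R\}_{R\in\mathcal Q}$ nonnegative constants. With $\mathbb E_R(g)=|R|^{-1}\int_R g$, put $$\overline T(f\sigma)=\Big(\sum_{R\in\mathcal Q}\big|\tau_R\,\mathbb E_R(f\sigma)\mathbf 1_R\big|^q\Big)^{1/q},\qquad U(\{h_R\}_{R\in\mathcal Q})=\sum_{R\in\mathcal Q}\tau_R\,\mathbb E_R(h_R)\mathbf 1_R .$$ Let $B$ be the class of sequences of measurable functions $\{a_R\}_{R\in\mathcal Q}$ such that each $a_R$ vanishes off $R$ and $\big(\sum_{R\in\mathcal Q}|a_R(x)|^{q'}\big)^{1/q'}=1$ for almost every $x\in\bigcup_{R\in\mathcal Q}R$. Define, in $[0,\infty]$, $$\mathcal L=\sup_{Q\in\mathcal D}\ \sup_{\{a_R\}\in B}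 w(Q)^{-r'/p'}\int_Q\big|U(\{\mathbf 1_{Q\cap R}\,a_R\,w\}_{R\in\mathcal Q})\big|^{r'}\sigma,\qquad \mathcal L_*=\sup_{Q\in\mathcal D}\sigma(Q)^{-p/r}\int_Q\overline T(\mathbf 1_Q\sigma)^p\,w ,$$ where $|U(\cdot)|$ is given the value $\infty$ at points where the series does not converge absolutely. Then $\overline T(\cdot\,\sigma)$ is bounded from $L^r(\sigma)$ to $L^p(w)$ if and only if $\mathcal L<\infty$ and $\mathcal L_*<\infty$. Moreover there is a constant $K>0$ depending only on $d,r,p,q$ such that $$K^{-1}\max\{\mathcal L^{1/r'},\mathcal L_*^{1/p}\}\le\|\overline T(\cdot\,\sigma)\|_{L^r(\sigma)\to L^p(w)}\le K\max\{\mathcal L^{1/r'},\mathcal L_*^{1/p}\}.$$ -/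

import Mathlib

open MeasureTheory Set
open scoped ENNReal NNReal

noncomputable section

namespace VectorDyadic

/-- `Q` is a half-open cube `∏ᵢ [aᵢ, aᵢ + ℓ)` in `ℝᵈ`, of side length `ℓ`. -/
def IsCube {d : ℕ} (l : ℝ) (Q : Set (Fin d → ℝ)) : Prop :=
  ∃ a : Fin d → ℝ, Q = {x | ∀ i, a i ≤ x i ∧ x i < a i + l}

/-- A dyadic grid in `ℝᵈ`: a family of half-open cubes whose side lengths are integer powers of
two, any two of which are nested or disjoint, such that for every `k : ℤ` the cubes of side
length `2 ^ k` cover `ℝᵈ` (and hence partition it). -/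
structure IsDyadicGrid {d : ℕ} (D : Set (Set (Fin d → ℝ))) : Prop where
  isCube : ∀ Q ∈ D, ∃ k : ℤ, IsCube ((2 : ℝ) ^ k) Q
  nested : ∀ Q ∈ D, ∀ R ∈ D, Q ⊆ R ∨ R ⊆ Q ∨ Disjoint Q R
  cover : ∀ (k : ℤ) (x : Fin d → ℝ), ∃ Q ∈ D, IsCube ((2 : ℝ) ^ k) Q ∧ x ∈ Q

/-- A weight on `ℝᵈ`: a locally integrable function that is positive almost everywhere. -/
structure IsWeight {d : ℕ} (ω : (Fin d → ℝ) → ℝ) : Prop where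
  locallyIntegrable : LocallyIntegrable ω volume
  pos : ∀ᵐ x, 0 < ω x

/-- The measure `ω dx` attached to a weight `ω`. -/
def wMeasure {d : ℕ} (ω : (Fin d → ℝ) → ℝ) : Measure (Fin d → ℝ) :=
  volume.withDensity (fun x => ENNReal.ofReal (ω x))

/-- The Lebesgue average `𝔼_Q g = |Q|⁻¹ ∫_Q g`. -/
def avg {d : ℕ} (Q : Set (Fin d → ℝ)) (g : (Fin d → ℝ) → ℝ) : ℝ :=
  (volume.real Q)⁻¹ * ∫ x in Q, g x

variable {d : ℕ} {𝒬 : Set (Set (Fin d → ℝ))}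

/-- The operator `T̄(fσ)(x) = (∑_{R ∈ 𝒬} |τ_R 𝔼_R(fσ) 1_R(x)|^q)^{1/q}`, with values
in `[0, ∞]`. -/
def Tbar (q : ℝ) (τ : 𝒬 → ℝ≥0) (σ f : (Fin d → ℝ) → ℝ) (x : Fin d → ℝ) : ℝ≥0∞ :=
  (∑' R : 𝒬, ‖(R : Set (Fin d → ℝ)).indicator
    (fun _ => (τ R : ℝ) * avg (R : Set (Fin d → ℝ)) (fun y => f y * σ y)) x‖ₑ ^ q) ^ (1 / q)

open Classical in
/-- The absolute value `|U({h_R})(x)| = |∑_{R ∈ 𝒬} 𝔼_R(h_R) τ_R 1_R(x)|`, with the value `∞` at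
the points where the series does not converge (absolutely). -/
def absU (τ : 𝒬 → ℝ≥0) (h : 𝒬 → (Fin d → ℝ) → ℝ) (x : Fin d → ℝ) : ℝ≥0∞ :=
  if Summable (fun R : 𝒬 => (R : Set (Fin d → ℝ)).indicator
      (fun _ => avg (R : Set (Fin d → ℝ)) (h R) * (τ R : ℝ)) x)
  then ‖∑' R : 𝒬, (R : Set (Fin d → ℝ)).indicator
      (fun _ => avg (R : Set (Fin d → ℝ)) (h R) * (τ R : ℝ)) x‖ₑ
  else ∞

/-- The class `B` (for the exponent `s = q'`): sequences of measurable functions `{a_R}`, each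
`a_R` vanishing off `R`, whose `ℓ^s` norm is `1` at almost every point of `⋃_{R ∈ 𝒬} R`
(elsewhere all the `a_R` vanish). -/
structure MemB (s : ℝ) (a : 𝒬 → (Fin d → ℝ) → ℝ) : Prop where
  aemeasurable : ∀ R, AEMeasurable (a R) volume
  norm_eq_one : ∀ᵐ x, x ∈ ⋃₀ 𝒬 → (∑' R : 𝒬, ‖a R x‖ₑ ^ s) ^ (1 / s) = 1
  support_subset : ∀ R : 𝒬, Function.support (a R) ⊆ (R : Set (Fin d → ℝ))

/-- `C` is an admissible constant in `‖T̄(fσ)‖_{L^p(w)} ≤ C ‖f‖_{L^r(σ)}`. -/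
def BoundedBy (r p q : ℝ) (τ : 𝒬 → ℝ≥0) (σ w : (Fin d → ℝ) → ℝ) (C : ℝ≥0∞) : Prop :=
  ∀ f : (Fin d → ℝ) → ℝ, MemLp f (ENNReal.ofReal r) (wMeasure σ) →
    eLpNorm (Tbar q τ σ f) (ENNReal.ofReal p) (wMeasure w) ≤
      C * eLpNorm f (ENNReal.ofReal r) (wMeasure σ)

/-- `T̄(·σ)` is bounded from `L^r(σ)` to `L^p(w)`. -/
def IsBoundedOp (r p q : ℝ) (τ : 𝒬 → ℝ≥0) (σ w : (Fin d → ℝ) → ℝ) : Prop :=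
  ∃ C : ℝ≥0, BoundedBy r p q τ σ w C

/-- The operator norm of `T̄(·σ) : L^r(σ) → L^p(w)`, which is `∞` when it is unbounded. -/
def opNorm (r p q : ℝ) (τ : 𝒬 → ℝ≥0) (σ w : (Fin d → ℝ) → ℝ) : ℝ≥0∞ :=
  sInf {C : ℝ≥0∞ | BoundedBy r p q τ σ w C}

/-- The testing constant `𝓛_*` for `T̄`. -/
def directTesting (r p q : ℝ) (D : Set (Set (Fin d → ℝ))) (τ : 𝒬 → ℝ≥0)
    (σ w : (Fin d → ℝ) → ℝ) : ℝ≥0∞ :=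
  ⨆ Q ∈ D, wMeasure σ Q ^ (-(p / r)) *
    ∫⁻ x in Q, Tbar q τ σ (Q.indicator fun _ => 1) x ^ p ∂(wMeasure w)

/-- The testing constant `𝓛` for the dual operator `U`; `r'`, `p'`, `q'` are the conjugate
exponents. -/
def dualTesting (r p q : ℝ) (D : Set (Set (Fin d → ℝ))) (τ : 𝒬 → ℝ≥0)
    (σ w : (Fin d → ℝ) → ℝ) : ℝ≥0∞ :=
  ⨆ Q ∈ D, ⨆ a ∈ {a : 𝒬 → (Fin d → ℝ) → ℝ | MemB q.conjExponent a},
    wMeasure w Q ^ (-(r.conjExponent / p.conjExponent)) *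
      ∫⁻ x in Q, absU τ (fun R => (Q ∩ (R : Set (Fin d → ℝ))).indicator fun y => a R y * w y) x
        ^ r.conjExponent ∂(wMeasure σ)

end VectorDyadic

end

namespace VectorDyadic

section ENNRealLemmas

lemma two_zpow_mono {j k : ℤ} (h : j ≤ k) : (2 : ℝ≥0∞) ^ j ≤ 2 ^ k :=
  ENNReal.zpow_le_of_le (by norm_num) h

lemma two_zpow_succ (k : ℤ) : (2 : ℝ≥0∞) ^ (k + 1) = 2 * 2 ^ k := by
  rw [ENNReal.zpow_add (by simp) (by simp), zpow_one, mul_comm]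

lemma exists_two_zpow_lt_le {t : ℝ≥0∞} (h0 : t ≠ 0) (ht : t ≠ ∞) :
    ∃ n : ℤ, (2 : ℝ≥0∞) ^ n < t ∧ t ≤ 2 ^ (n + 1) := by
  obtain ⟨n, hn⟩ := ENNReal.exists_mem_Ioc_zpow h0 ht (y := 2) (by norm_num) (by simp)
  exact ⟨n, hn.1, hn.2⟩

/-- The sum of the geometric series of ratio `2 ^ (-s)`. -/
noncomputable def geomConst (s : ℝ) : ℝ≥0∞ := (1 - (2 : ℝ≥0∞) ^ (-s))⁻¹

lemma geomConst_ne_zero (s : ℝ) : geomConst s ≠ 0 := by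
  simp [geomConst]

lemma geomConst_ne_top {s : ℝ} (hs : 0 < s) : geomConst s ≠ ∞ := by
  have : (2 : ℝ≥0∞) ^ (-s) < 1 := ENNReal.rpow_lt_one_of_one_lt_of_neg (by norm_num) (by linarith)
  rw [geomConst, Ne, ENNReal.inv_eq_top, tsub_eq_zero_iff_le]
  exact not_le.2 this

lemma tsum_two_zpow_lt_le {s : ℝ} (hs : 0 < s) (t : ℝ≥0∞) :
    ∑' k : ℤ, (if (2 : ℝ≥0∞) ^ k < t then ((2 : ℝ≥0∞) ^ k) ^ s else 0) ≤ geomConst s * t ^ s := by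
  rcases eq_or_ne t 0 with rfl | h0
  · simp
  rcases eq_or_ne t ∞ with rfl | ht
  · rw [ENNReal.top_rpow_of_pos hs, ENNReal.mul_top (geomConst_ne_zero s)]
    exact le_top
  obtain ⟨n, hn, hn'⟩ := exists_two_zpow_lt_le h0 ht
  have key : ∑' k : ℤ, (if k ≤ n then ((2 : ℝ≥0∞) ^ k) ^ s else 0)
      = ((2 : ℝ≥0∞) ^ n) ^ s * geomConst s := by
    have hinj : Function.Injective (fun i : ℕ => n - (i : ℤ)) := fun i j h => by
      simpa using h
    rw [← hinj.tsum_eq (f := fun k : ℤ => if k ≤ n then ((2 : ℝ≥0∞) ^ k) ^ s else 0), geomConst,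
      ← ENNReal.tsum_geometric, ← ENNReal.tsum_mul_left]
    · refine tsum_congr fun i => ?_
      rw [if_pos (by omega), sub_eq_add_neg, ENNReal.zpow_add (by simp) (by simp),
        ENNReal.mul_rpow_of_nonneg _ _ hs.le]
      congr 1
      rw [← ENNReal.rpow_natCast, ← ENNReal.rpow_mul, ← ENNReal.rpow_intCast, ← ENNReal.rpow_mul]
      congr 1
      push_cast
      ring
    · intro k hk
      have hk' : k ≤ n := by
        by_contra h
        simp [h] at hk
      exact ⟨(n - k).toNat, by simp; omega⟩
  calc ∑' k : ℤ, (if (2 : ℝ≥0∞) ^ k < t then ((2 : ℝ≥0∞) ^ k) ^ s else 0)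
      ≤ ∑' k : ℤ, (if k ≤ n then ((2 : ℝ≥0∞) ^ k) ^ s else 0) := by
        refine ENNReal.tsum_le_tsum fun k => ?_
        by_cases h : k ≤ n
        · rw [if_pos h]
          split_ifs <;> simp
        · rw [if_neg h, if_neg]
          exact not_lt.2 (hn'.trans (two_zpow_mono (by omega)))
    _ = geomConst s * ((2 : ℝ≥0∞) ^ n) ^ s := by rw [key, mul_comm]
    _ ≤ _ := by gcongr

lemma tsum_rpow_le_rpow_tsum {ι : Type*} (x : ι → ℝ≥0∞) {s : ℝ} (hs : 1 ≤ s) :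
    ∑' i, x i ^ s ≤ (∑' i, x i) ^ s := by
  have h : ∀ y : ℝ≥0∞, y ^ s = y * y ^ (s - 1) := fun y => by
    nth_rewrite 2 [← ENNReal.rpow_one y]
    rw [← ENNReal.rpow_add_of_nonneg _ _ zero_le_one (by linarith)]
    congr 1; ring
  rw [h, ← ENNReal.tsum_mul_right]
  refine ENNReal.tsum_le_tsum fun i => ?_
  rw [h]
  exact mul_le_mul_right (ENNReal.rpow_le_rpow (ENNReal.le_tsum i) (by linarith)) _

lemma tsum_tsub_succ_le {β : ℤ → ℝ≥0∞} (hβ : Monotone β) {M : ℝ≥0∞} (hM : ∀ k, β k ≤ M) :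
    ∑' k, (β (k + 1) - β k) ≤ M := by
  rw [ENNReal.tsum_eq_iSup_sum]
  refine iSup_le fun s => ?_
  have key : ∀ (a : ℤ) (n : ℕ),
      ∑ i ∈ Finset.range n, (β (a + i + 1) - β (a + i)) + β a = β (a + n) := by
    intro a n
    induction n with
    | zero => simp
    | succ n ih =>
      rw [Finset.sum_range_succ, add_right_comm, ih, add_comm, tsub_add_cancel_of_le
        (hβ (by omega))]
      push_cast
      rw [add_assoc]
  obtain ⟨a, ha⟩ := s.bddBelow
  obtain ⟨b, hb⟩ := s.bddAbove
  have hsub : s ⊆ (Finset.range (b - a + 1).toNat).image (fun i : ℕ => a + (i : ℤ)) := by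
    intro k hk
    have h1 := ha hk
    have h2 := hb hk
    simp only [Finset.mem_image, Finset.mem_range]
    exact ⟨(k - a).toNat, by omega, by omega⟩
  calc ∑ k ∈ s, (β (k + 1) - β k)
      ≤ ∑ k ∈ (Finset.range (b - a + 1).toNat).image (fun i : ℕ => a + (i : ℤ)),
          (β (k + 1) - β k) := Finset.sum_le_sum_of_subset hsub
    _ = ∑ i ∈ Finset.range (b - a + 1).toNat, (β (a + i + 1) - β (a + i)) :=
        Finset.sum_image (fun i _ j _ h => by simpa using h)
    _ ≤ β (a + (b - a + 1).toNat) := by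
        rw [← key]
        exact le_self_add
    _ ≤ M := hM _

lemma tsum_tsub_add_two_le {β : ℤ → ℝ≥0∞} (hβ : Monotone β) {M : ℝ≥0∞} (hM : ∀ k, β k ≤ M) :
    ∑' k, (β (k + 2) - β k) ≤ 2 * M := by
  calc ∑' k, (β (k + 2) - β k)
      ≤ ∑' k, ((β (k + 1 + 1) - β (k + 1)) + (β (k + 1) - β k)) := by
        refine ENNReal.tsum_le_tsum fun k => ?_
        rw [show k + 2 = k + 1 + 1 by ring]
        exact tsub_le_tsub_add_tsub
    _ = ∑' k, (β (k + 1 + 1) - β (k + 1)) + ∑' k, (β (k + 1) - β k) := ENNReal.tsum_add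
    _ = ∑' k, (β (k + 1) - β k) + ∑' k, (β (k + 1) - β k) := by
        congr 1
        exact (Equiv.addRight (1 : ℤ)).tsum_eq (fun k => β (k + 1) - β k)
    _ ≤ M + M := add_le_add (tsum_tsub_succ_le hβ hM) (tsum_tsub_succ_le hβ hM)
    _ = 2 * M := (two_mul M).symm

lemma tsum_doubling_le {β : ℤ → ℝ≥0∞} (hβ : Monotone β) {M : ℝ≥0∞} (hMt : M ≠ ∞)
    (hM : ∀ k, β k ≤ M) {r : ℝ} (hr : 1 ≤ r) :
    ∑' k, (if 2 * β k < β (k + 2) then β (k + 2) else 0) ^ r ≤ 4 * M ^ r := by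
  have hr0 : 0 ≤ r := by linarith
  have hb : ∀ k, β k ^ r ≤ M ^ r := fun k => ENNReal.rpow_le_rpow (hM k) hr0
  have hbt : ∀ k, β k ^ r ≠ ∞ := fun k =>
    ne_top_of_le_ne_top (ENNReal.rpow_ne_top_of_nonneg hr0 hMt) (hb k)
  calc ∑' k, (if 2 * β k < β (k + 2) then β (k + 2) else 0) ^ r
      ≤ ∑' k, 2 * (β (k + 2) ^ r - β k ^ r) := by
        refine ENNReal.tsum_le_tsum fun k => ?_
        split_ifs with h
        · have h1 : 2 * β k ^ r ≤ β (k + 2) ^ r := by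
            calc 2 * β k ^ r ≤ 2 ^ r * β k ^ r := by
                  gcongr
                  simpa using ENNReal.rpow_le_rpow_of_exponent_le (x := 2) (by norm_num) hr
              _ = (2 * β k) ^ r := (ENNReal.mul_rpow_of_nonneg _ _ hr0).symm
              _ ≤ _ := ENNReal.rpow_le_rpow h.le hr0
          rw [ENNReal.mul_sub (fun _ _ => by simp)]
          refine ENNReal.le_sub_of_add_le_left (ENNReal.mul_ne_top (by simp) (hbt k)) ?_
          rw [two_mul (β (k + 2) ^ r)]
          gcongr
        · rw [ENNReal.zero_rpow_of_pos (by linarith)]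
          exact zero_le
    _ = 2 * ∑' k, (β (k + 2) ^ r - β k ^ r) := ENNReal.tsum_mul_left
    _ ≤ 2 * (2 * M ^ r) := by
        gcongr
        exact tsum_tsub_add_two_le (β := fun k => β k ^ r)
          (fun i j h => ENNReal.rpow_le_rpow (hβ h) hr0) hb
    _ = 4 * M ^ r := by rw [← mul_assoc]; norm_num

lemma tsum_two_zpow_window_le (t c : ℝ≥0∞) :
    ∑' k : ℤ, (if (2 : ℝ≥0∞) ^ k < t ∧ t ≤ 2 ^ (k + 2) then c else 0) ≤ 2 * c := by
  have h := tsum_tsub_add_two_le (β := fun k : ℤ => if t ≤ (2 : ℝ≥0∞) ^ k then 1 else 0) (M := 1)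
    (fun i j hij => by
      dsimp only
      split_ifs with h1 h2 <;> first | exact le_rfl | exact zero_le | skip
      exact absurd (h1.trans (two_zpow_mono hij)) h2)
    (fun k => by split_ifs <;> simp)
  calc ∑' k : ℤ, (if (2 : ℝ≥0∞) ^ k < t ∧ t ≤ 2 ^ (k + 2) then c else 0)
      ≤ ∑' k : ℤ, ((if t ≤ (2 : ℝ≥0∞) ^ (k + 2) then 1 else 0)
          - (if t ≤ (2 : ℝ≥0∞) ^ k then 1 else 0)) * c := by
        refine ENNReal.tsum_le_tsum fun k => ?_
        by_cases h : (2 : ℝ≥0∞) ^ k < t ∧ t ≤ 2 ^ (k + 2)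
        · rw [if_pos h, if_pos h.2, if_neg (not_le.2 h.1)]
          simp
        · rw [if_neg h]
          exact zero_le
    _ ≤ 2 * c := by
        rw [ENNReal.tsum_mul_right]
        gcongr
        simpa using h

lemma rpow_le_tsum_two_zpow_window {t : ℝ≥0∞} (ht : t ≠ ∞) {p : ℝ} (hp : 0 < p) :
    t ^ p ≤ ∑' k : ℤ, (if (2 : ℝ≥0∞) ^ (k + 1) < t ∧ t ≤ 2 ^ (k + 2)
      then ((2 : ℝ≥0∞) ^ (k + 2)) ^ p else 0) := by
  rcases eq_or_ne t 0 with rfl | h0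
  · simp [hp]
  obtain ⟨n, hn, hn'⟩ := exists_two_zpow_lt_le h0 ht
  refine le_trans ?_ (ENNReal.le_tsum (n - 1))
  rw [if_pos ⟨by simpa using hn, by rwa [show n - 1 + 2 = n + 1 by ring]⟩,
    show n - 1 + 2 = n + 1 by ring]
  gcongr

lemma rpow_sub_one_mul {p : ℝ} (hp : 1 ≤ p) (e : ℝ≥0∞) : e ^ (p - 1) * e = e ^ p := by
  nth_rewrite 2 [← ENNReal.rpow_one e]
  rw [← ENNReal.rpow_add_of_nonneg _ _ (by linarith) zero_le_one]
  congr 1; ring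

lemma rpow_mul_le_of_mul_le_add {p : ℝ} (hp : 1 ≤ p) {t e W X Y x y ε : ℝ≥0∞} (he : e ≠ ∞)
    (hε : ε ≠ 0) (hε' : ε ≠ ∞) (h : t * e ≤ X + Y) (hX : X ^ p ≤ x * W ^ (p - 1))
    (hY : Y ^ p ≤ y * e ^ (p - 1)) :
    t ^ p * e ≤ ε * (t ^ p * W) + 2 ^ (p - 1) * (ε⁻¹ ^ (p - 1) * x + y) := by
  have hp0 : 0 ≤ p := by linarith
  have hp1 : 0 ≤ p - 1 := by linarith
  rcases le_or_gt e (ε * W) with h1 | h1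
  · refine le_trans ?_ le_self_add
    calc t ^ p * e ≤ t ^ p * (ε * W) := by gcongr
      _ = _ := by ring
  · refine le_trans ?_ le_add_self
    have he0 : e ≠ 0 := (lt_of_le_of_lt zero_le h1).ne'
    have hW : W ≤ ε⁻¹ * e := by
      rw [mul_comm, ← div_eq_mul_inv, ENNReal.le_div_iff_mul_le (Or.inl hε) (Or.inl hε'), mul_comm]
      exact h1.le
    have hz : e ^ (p - 1) ≠ 0 := (ENNReal.rpow_pos (pos_iff_ne_zero.2 he0) he).ne'
    have hzt : e ^ (p - 1) ≠ ∞ := ENNReal.rpow_ne_top_of_nonneg hp1 he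
    rw [← ENNReal.mul_le_mul_iff_left hz hzt]
    calc t ^ p * e * e ^ (p - 1) = (t * e) ^ p := by
          rw [ENNReal.mul_rpow_of_nonneg _ _ hp0, mul_assoc, mul_comm e, rpow_sub_one_mul hp]
      _ ≤ (X + Y) ^ p := by gcongr
      _ ≤ 2 ^ (p - 1) * (X ^ p + Y ^ p) := ENNReal.rpow_add_le_mul_rpow_add_rpow _ _ hp
      _ ≤ 2 ^ (p - 1) * (x * (ε⁻¹ * e) ^ (p - 1) + y * e ^ (p - 1)) := by
          gcongr
          exact hX.trans (by gcongr)
      _ = _ := by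
          rw [ENNReal.mul_rpow_of_nonneg _ _ hp1]
          ring

end ENNRealLemmas

section MaximalFunction

open Classical in
/-- The members `Q` of `𝒬` with `t < φ Q` which are maximal, in the sense that `φ ≤ t` on all
members of `𝒬` strictly containing `Q`. -/
noncomputable def maxCubes {X : Type*} (𝒬 : Finset (Set X)) (φ : Set X → ℝ≥0∞) (t : ℝ≥0∞) :
    Finset (Set X) :=
  𝒬.filter fun Q => t < φ Q ∧ ∀ R ∈ 𝒬, Q ⊂ R → φ R ≤ t

/-- The maximal function `x ↦ sup {φ R : x ∈ R ∈ 𝒬}`. -/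
noncomputable def maxFun {X : Type*} (𝒬 : Finset (Set X)) (φ : Set X → ℝ≥0∞) (x : X) : ℝ≥0∞ :=
  𝒬.sup fun R => R.indicator (fun _ => φ R) x

open Classical in
/-- The supremum of `φ` over the members of `𝒬` containing `Q`. -/
noncomputable def ancestorSup {X : Type*} (𝒬 : Finset (Set X)) (φ : Set X → ℝ≥0∞) (Q : Set X) :
    ℝ≥0∞ :=
  (𝒬.filter (Q ⊆ ·)).sup φ

/-- A finite family of measurable sets, pairwise nested or disjoint. -/
structure IsTree {X : Type*} [MeasurableSpace X] (𝒬 : Finset (Set X)) : Prop where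
  meas : ∀ Q ∈ 𝒬, MeasurableSet Q
  nonempty : ∀ Q ∈ 𝒬, Q.Nonempty
  nested : ∀ Q ∈ 𝒬, ∀ R ∈ 𝒬, Q ⊆ R ∨ R ⊆ Q ∨ Disjoint Q R

/-- The average of `f` over `Q` with respect to `μ`. -/
noncomputable def mean {X : Type*} [MeasurableSpace X] (μ : Measure X) (f : X → ℝ≥0∞)
    (Q : Set X) : ℝ≥0∞ :=
  (∫⁻ x in Q, f x ∂μ) / μ Q

variable {X : Type*} {𝒬 : Finset (Set X)} {φ : Set X → ℝ≥0∞} {t : ℝ≥0∞} {x : X} {Q R : Set X}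

lemma mem_maxCubes : Q ∈ maxCubes 𝒬 φ t ↔
    Q ∈ 𝒬 ∧ t < φ Q ∧ ∀ R ∈ 𝒬, Q ⊂ R → φ R ≤ t := by
  simp [maxCubes]

lemma exists_maxCubes_superset (hR : R ∈ 𝒬) (h : t < φ R) : ∃ Q ∈ maxCubes 𝒬 φ t, R ⊆ Q := by
  classical
  obtain ⟨Q, hRQ, hQ⟩ := (𝒬.filter fun Q => t < φ Q).exists_le_maximal
    (Finset.mem_filter.2 ⟨hR, h⟩)
  have hQm := Finset.mem_filter.1 hQ.prop
  refine ⟨Q, mem_maxCubes.2 ⟨hQm.1, hQm.2, fun S hS hQS => ?_⟩, hRQ⟩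
  by_contra hlt
  exact hQS.2 (hQ.le_of_ge (Finset.mem_filter.2 ⟨hS, not_le.1 hlt⟩) hQS.1)

lemma lt_maxFun_iff : t < maxFun 𝒬 φ x ↔ ∃ R ∈ 𝒬, x ∈ R ∧ t < φ R := by
  rw [maxFun, Finset.lt_sup_iff]
  refine exists_congr fun R => and_congr_right fun _ => ?_
  by_cases h : x ∈ R <;> simp [h]

lemma le_maxFun (hR : R ∈ 𝒬) (hx : x ∈ R) : φ R ≤ maxFun 𝒬 φ x := by
  refine le_trans (le_of_eq ?_) (Finset.le_sup (f := fun R => R.indicator (fun _ => φ R) x) hR)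
  simp [hx]

lemma lt_maxFun_iff_maxCubes : t < maxFun 𝒬 φ x ↔ ∃ Q ∈ maxCubes 𝒬 φ t, x ∈ Q := by
  rw [lt_maxFun_iff]
  constructor
  · rintro ⟨R, hR, hx, h⟩
    obtain ⟨Q, hQ, hRQ⟩ := exists_maxCubes_superset hR h
    exact ⟨Q, hQ, hRQ hx⟩
  · rintro ⟨Q, hQ, hx⟩
    exact ⟨Q, (mem_maxCubes.1 hQ).1, hx, (mem_maxCubes.1 hQ).2.1⟩

lemma setOf_lt_maxFun : {x | t < maxFun 𝒬 φ x} = ⋃ Q ∈ maxCubes 𝒬 φ t, Q := by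
  ext x
  simp [lt_maxFun_iff_maxCubes]

lemma maxFun_rpow_le_sum {r : ℝ} (hr : 0 < r) :
    maxFun 𝒬 φ x ^ r ≤ ∑ R ∈ 𝒬, R.indicator (fun _ => φ R ^ r) x := by
  rw [maxFun, ← ENNReal.le_rpow_inv_iff hr]
  refine Finset.sup_le fun R hR => ?_
  rw [ENNReal.le_rpow_inv_iff hr]
  refine le_trans (le_of_eq ?_)
    (Finset.single_le_sum (f := fun R : Set X => R.indicator (fun _ => φ R ^ r) x)
      (fun _ _ => zero_le) hR)
  by_cases hx : x ∈ R <;> simp [hx, hr]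

lemma le_ancestorSup (hR : R ∈ 𝒬) (h : Q ⊆ R) : φ R ≤ ancestorSup 𝒬 φ Q := by
  classical
  exact Finset.le_sup (f := φ) (Finset.mem_filter.2 ⟨hR, h⟩)

lemma lt_ancestorSup_iff : t < ancestorSup 𝒬 φ Q ↔ ∃ R ∈ 𝒬, Q ⊆ R ∧ t < φ R := by
  classical
  rw [ancestorSup, Finset.lt_sup_iff]
  simp [and_assoc]

variable [MeasurableSpace X]

lemma IsTree.subset_or_ssubset (h𝒬 : IsTree 𝒬) (hQ : Q ∈ 𝒬) (hR : R ∈ 𝒬) (hxQ : x ∈ Q)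
    (hxR : x ∈ R) : Q ⊆ R ∨ R ⊂ Q := by
  rcases h𝒬.nested Q hQ R hR with h | h | h
  · exact Or.inl h
  · by_cases h' : Q ⊆ R
    · exact Or.inl h'
    · exact Or.inr ⟨h, h'⟩
  · exact absurd hxR (disjoint_left.1 h hxQ)

lemma IsTree.filter (h𝒬 : IsTree 𝒬) (P : Set X → Prop) [DecidablePred P] :
    IsTree (𝒬.filter P) where
  meas Q hQ := h𝒬.meas Q (Finset.mem_of_mem_filter Q hQ)
  nonempty Q hQ := h𝒬.nonempty Q (Finset.mem_of_mem_filter Q hQ)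
  nested Q hQ R hR := h𝒬.nested Q (Finset.mem_of_mem_filter Q hQ) R (Finset.mem_of_mem_filter R hR)

lemma IsTree.pairwiseDisjoint_maxCubes (h𝒬 : IsTree 𝒬) (φ : Set X → ℝ≥0∞) (t : ℝ≥0∞) :
    (maxCubes 𝒬 φ t : Set (Set X)).PairwiseDisjoint id := by
  intro Q hQ R hR hne
  have hQ := mem_maxCubes.1 hQ
  have hR := mem_maxCubes.1 hR
  rcases h𝒬.nested Q hQ.1 R hR.1 with h | h | h
  · exact absurd (hQ.2.2 R hR.1 (h.ssubset_of_ne hne)) (not_le.2 hR.2.1)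
  · exact absurd (hR.2.2 Q hQ.1 (h.ssubset_of_ne hne.symm)) (not_le.2 hQ.2.1)
  · exact h

lemma IsTree.measurable_maxFun (h𝒬 : IsTree 𝒬) (φ : Set X → ℝ≥0∞) : Measurable (maxFun 𝒬 φ) := by
  refine measurable_of_Ioi fun t => ?_
  have : maxFun 𝒬 φ ⁻¹' Ioi t = ⋃ Q ∈ maxCubes 𝒬 φ t, Q := setOf_lt_maxFun
  rw [this]
  exact Finset.measurableSet_biUnion _ fun Q hQ => h𝒬.meas Q (mem_maxCubes.1 hQ).1

lemma IsTree.sum_measure_maxCubes (h𝒬 : IsTree 𝒬) (φ : Set X → ℝ≥0∞) (t : ℝ≥0∞) (μ : Measure X) :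
    ∑ Q ∈ maxCubes 𝒬 φ t, μ Q = μ {x | t < maxFun 𝒬 φ x} := by
  rw [setOf_lt_maxFun, measure_biUnion_finset (f := fun Q => Q) (h𝒬.pairwiseDisjoint_maxCubes φ t)]
  · exact fun Q hQ => h𝒬.meas Q (mem_maxCubes.1 hQ).1

lemma IsTree.sum_setLIntegral_maxCubes (h𝒬 : IsTree 𝒬) (φ : Set X → ℝ≥0∞) (t : ℝ≥0∞)
    (μ : Measure X) (f : X → ℝ≥0∞) :
    ∑ Q ∈ maxCubes 𝒬 φ t, ∫⁻ x in Q, f x ∂μ = ∫⁻ x in {x | t < maxFun 𝒬 φ x}, f x ∂μ := by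
  rw [setOf_lt_maxFun, lintegral_biUnion_finset (t := fun Q => Q) (h𝒬.pairwiseDisjoint_maxCubes φ t)]
  exact fun Q hQ => h𝒬.meas Q (mem_maxCubes.1 hQ).1

/-- The dyadic `L ^ r` norm (to the power `r`) of the maximal function, computed from its level
sets. -/
noncomputable def levelSum (𝒬 : Finset (Set X)) (φ : Set X → ℝ≥0∞) (r : ℝ) (μ : Measure X) :
    ℝ≥0∞ :=
  ∑' k : ℤ, ((2 : ℝ≥0∞) ^ k) ^ r * μ {x | 2 ^ k < maxFun 𝒬 φ x}

lemma IsTree.measurableSet_lt_maxFun (h𝒬 : IsTree 𝒬) (φ : Set X → ℝ≥0∞) (t : ℝ≥0∞) :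
    MeasurableSet {x | t < maxFun 𝒬 φ x} :=
  measurableSet_lt measurable_const (h𝒬.measurable_maxFun φ)

lemma IsTree.levelSum_le (h𝒬 : IsTree 𝒬) (φ : Set X → ℝ≥0∞) {r : ℝ} (hr : 0 < r)
    (μ : Measure X) : levelSum 𝒬 φ r μ ≤ geomConst r * ∫⁻ x, maxFun 𝒬 φ x ^ r ∂μ := by
  have hm := h𝒬.measurable_maxFun φ
  calc levelSum 𝒬 φ r μ
      = ∑' k : ℤ, ∫⁻ x, (if (2 : ℝ≥0∞) ^ k < maxFun 𝒬 φ x then ((2 : ℝ≥0∞) ^ k) ^ r else 0) ∂μ := by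
        refine tsum_congr fun k => ?_
        rw [← lintegral_indicator_const (h𝒬.measurableSet_lt_maxFun φ _)]
        refine lintegral_congr fun x => ?_
        simp [indicator]
    _ = ∫⁻ x, ∑' k : ℤ, (if (2 : ℝ≥0∞) ^ k < maxFun 𝒬 φ x then ((2 : ℝ≥0∞) ^ k) ^ r else 0) ∂μ := by
        rw [lintegral_tsum]
        exact fun k => (Measurable.ite (h𝒬.measurableSet_lt_maxFun φ _) measurable_const
          measurable_const).aemeasurable
    _ ≤ ∫⁻ x, geomConst r * maxFun 𝒬 φ x ^ r ∂μ :=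
        lintegral_mono fun x => tsum_two_zpow_lt_le hr _
    _ = _ := lintegral_const_mul _ (hm.pow_const r)

lemma IsTree.lintegral_maxFun_rpow_le (h𝒬 : IsTree 𝒬) (hφ : ∀ Q ∈ 𝒬, φ Q ≠ ∞) {r : ℝ}
    (hr : 0 < r) (μ : Measure X) :
    ∫⁻ x, maxFun 𝒬 φ x ^ r ∂μ ≤ 2 ^ r * levelSum 𝒬 φ r μ := by
  have hM : ∀ x, maxFun 𝒬 φ x ≠ ∞ := fun x => by
    have h : maxFun 𝒬 φ x < ∞ := by
      rw [maxFun, Finset.sup_lt_iff (by simp)]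
      intro R hR
      by_cases hx : x ∈ R <;> simp [hx, (hφ R hR).lt_top]
    exact h.ne
  calc ∫⁻ x, maxFun 𝒬 φ x ^ r ∂μ
      ≤ ∫⁻ x, ∑' k : ℤ, ({x | (2 : ℝ≥0∞) ^ (k + 1) < maxFun 𝒬 φ x}.indicator
          (fun _ => ((2 : ℝ≥0∞) ^ (k + 2)) ^ r)) x ∂μ := by
        refine lintegral_mono fun x => (rpow_le_tsum_two_zpow_window (hM x) hr).trans ?_
        refine ENNReal.tsum_le_tsum fun k => ?_
        split_ifs with h
        · simp [h.1]
        · exact zero_le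
    _ = ∑' k : ℤ, ((2 : ℝ≥0∞) ^ (k + 2)) ^ r * μ {x | (2 : ℝ≥0∞) ^ (k + 1) < maxFun 𝒬 φ x} := by
        rw [lintegral_tsum]
        · refine tsum_congr fun k => ?_
          rw [lintegral_indicator_const (h𝒬.measurableSet_lt_maxFun φ _)]
        · exact fun k => (measurable_const.indicator
            (h𝒬.measurableSet_lt_maxFun φ _)).aemeasurable
    _ = ∑' k : ℤ, 2 ^ r * (((2 : ℝ≥0∞) ^ (k + 1)) ^ r *
          μ {x | (2 : ℝ≥0∞) ^ (k + 1) < maxFun 𝒬 φ x}) := by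
        refine tsum_congr fun k => ?_
        rw [show k + 2 = k + 1 + 1 by ring, two_zpow_succ (k + 1),
          ENNReal.mul_rpow_of_nonneg _ _ hr.le, mul_assoc]
    _ = _ := by
        rw [ENNReal.tsum_mul_left, levelSum]
        congr 1
        exact (Equiv.addRight (1 : ℤ)).tsum_eq
          (fun k : ℤ => ((2 : ℝ≥0∞) ^ k) ^ r * μ {x | 2 ^ k < maxFun 𝒬 φ x})

variable {μ : Measure X} {f : X → ℝ≥0∞}

lemma mul_measure_le_of_le_mean (hμ : μ Q ≠ 0) (hμ' : μ Q ≠ ∞) (h : t ≤ mean μ f Q) :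
    t * μ Q ≤ ∫⁻ x in Q, f x ∂μ :=
  (ENNReal.le_div_iff_mul_le (Or.inl hμ) (Or.inl hμ')).1 h

lemma mean_mul_measure (hμ : μ Q ≠ 0) (hμ' : μ Q ≠ ∞) :
    mean μ f Q * μ Q = ∫⁻ x in Q, f x ∂μ :=
  ENNReal.div_mul_cancel hμ hμ'

lemma IsTree.levelSum_mean_le_aux (h𝒬 : IsTree 𝒬) (hμ : ∀ Q ∈ 𝒬, μ Q ≠ 0)
    (hμ' : ∀ Q ∈ 𝒬, μ Q ≠ ∞) (hf : Measurable f) {r : ℝ} (hr : 1 < r) :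
    levelSum 𝒬 (mean μ f) r μ ≤
      geomConst (r - 1) * ∫⁻ x, f x * maxFun 𝒬 (mean μ f) x ^ (r - 1) ∂μ := by
  have hm := h𝒬.measurable_maxFun (mean μ f)
  calc levelSum 𝒬 (mean μ f) r μ
      ≤ ∑' k : ℤ, ∫⁻ x, f x * (if (2 : ℝ≥0∞) ^ k < maxFun 𝒬 (mean μ f) x
          then ((2 : ℝ≥0∞) ^ k) ^ (r - 1) else 0) ∂μ := by
        refine ENNReal.tsum_le_tsum fun k => ?_
        have hS := h𝒬.measurableSet_lt_maxFun (mean μ f) (2 ^ k)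
        calc ((2 : ℝ≥0∞) ^ k) ^ r * μ {x | 2 ^ k < maxFun 𝒬 (mean μ f) x}
            = ((2 : ℝ≥0∞) ^ k) ^ (r - 1) * ∑ Q ∈ maxCubes 𝒬 (mean μ f) (2 ^ k), 2 ^ k * μ Q := by
              rw [← Finset.mul_sum, h𝒬.sum_measure_maxCubes, ← mul_assoc, rpow_sub_one_mul hr.le]
          _ ≤ ((2 : ℝ≥0∞) ^ k) ^ (r - 1) *
                ∑ Q ∈ maxCubes 𝒬 (mean μ f) (2 ^ k), ∫⁻ x in Q, f x ∂μ := by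
              gcongr with Q hQ
              have hQ' := mem_maxCubes.1 hQ
              exact mul_measure_le_of_le_mean (hμ Q hQ'.1) (hμ' Q hQ'.1) hQ'.2.1.le
          _ = _ := by
              rw [h𝒬.sum_setLIntegral_maxCubes, ← lintegral_const_mul _ hf,
                ← lintegral_indicator hS]
              refine lintegral_congr fun x => ?_
              by_cases hx : (2 : ℝ≥0∞) ^ k < maxFun 𝒬 (mean μ f) x <;> simp [hx, mul_comm]
    _ = ∫⁻ x, ∑' k : ℤ, f x * (if (2 : ℝ≥0∞) ^ k < maxFun 𝒬 (mean μ f) x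
          then ((2 : ℝ≥0∞) ^ k) ^ (r - 1) else 0) ∂μ := by
        rw [lintegral_tsum]
        exact fun k => (hf.mul (Measurable.ite (h𝒬.measurableSet_lt_maxFun _ _) measurable_const
          measurable_const)).aemeasurable
    _ ≤ ∫⁻ x, geomConst (r - 1) * (f x * maxFun 𝒬 (mean μ f) x ^ (r - 1)) ∂μ := by
        refine lintegral_mono fun x => ?_
        dsimp only
        rw [ENNReal.tsum_mul_left, mul_left_comm]
        gcongr
        exact tsum_two_zpow_lt_le (by linarith) _
    _ = _ := lintegral_const_mul _ (hf.mul (hm.pow_const _))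

/-- The constant in the maximal theorem. -/
noncomputable def maxConst (r : ℝ) : ℝ≥0∞ := (geomConst (r - 1) * 2 ^ (r - 1)) ^ r

lemma maxConst_ne_top {r : ℝ} (hr : 1 < r) : maxConst r ≠ ∞ :=
  ENNReal.rpow_ne_top_of_nonneg (by linarith) (ENNReal.mul_ne_top
    (geomConst_ne_top (by linarith)) (ENNReal.rpow_ne_top_of_nonneg (by linarith) (by simp)))

lemma mean_ne_top (hμ : μ Q ≠ 0) (hfin : μ Q ≠ ∞) (hf : AEMeasurable f μ) {r : ℝ} (hr : 1 < r)
    (hfr : ∫⁻ x, f x ^ r ∂μ ≠ ∞) : mean μ f Q ≠ ∞ := by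
  refine ENNReal.div_ne_top ?_ hμ
  have h := ENNReal.lintegral_mul_le_Lp_mul_Lq (μ.restrict Q) (Real.HolderConjugate.conjExponent hr)
    hf.restrict (aemeasurable_const (b := (1 : ℝ≥0∞)))
  simp only [Pi.mul_apply, mul_one, ENNReal.one_rpow, lintegral_one, Measure.restrict_apply_univ] at h
  refine ne_top_of_le_ne_top (ENNReal.mul_ne_top ?_ ?_) h
  · exact ENNReal.rpow_ne_top_of_nonneg (by positivity)
      (ne_top_of_le_ne_top hfr (setLIntegral_le_lintegral _ _))
  · exact ENNReal.rpow_ne_top_of_nonneg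
      (one_div_nonneg.2 (Real.HolderConjugate.conjExponent hr).symm.pos.le) hfin

/-- The maximal theorem for the maximal function of averages over a tree. -/
theorem IsTree.levelSum_mean_le (h𝒬 : IsTree 𝒬) (hμ : ∀ Q ∈ 𝒬, μ Q ≠ 0)
    (hμ' : ∀ Q ∈ 𝒬, μ Q ≠ ∞) (hf : Measurable f) {r : ℝ} (hr : 1 < r)
    (hfr : ∫⁻ x, f x ^ r ∂μ ≠ ∞) :
    levelSum 𝒬 (mean μ f) r μ ≤ maxConst r * ∫⁻ x, f x ^ r ∂μ := by
  have hr0 : 0 < r := by linarith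
  have hc := Real.HolderConjugate.conjExponent hr
  have hm := h𝒬.measurable_maxFun (mean μ f)
  have hφ : ∀ Q ∈ 𝒬, mean μ f Q ≠ ∞ := fun Q hQ =>
    mean_ne_top (hμ Q hQ) (hμ' Q hQ) hf.aemeasurable hr hfr
  set N := levelSum 𝒬 (mean μ f) r μ with hN
  have hNt : N ≠ ∞ := by
    refine ne_top_of_le_ne_top ?_ (h𝒬.levelSum_le (mean μ f) hr0 μ)
    refine ENNReal.mul_ne_top (geomConst_ne_top hr0) ?_
    refine ne_top_of_le_ne_top ?_ (lintegral_mono fun x => maxFun_rpow_le_sum hr0)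
    rw [lintegral_finsetSum _ fun R hR => measurable_const.indicator (h𝒬.meas R hR)]
    refine ENNReal.sum_ne_top.2 fun R hR => ?_
    rw [lintegral_indicator_const (h𝒬.meas R hR)]
    exact ENNReal.mul_ne_top (ENNReal.rpow_ne_top_of_nonneg hr0.le (hφ R hR)) (hμ' R hR)
  have h1 : N ≤ geomConst (r - 1) * ((∫⁻ x, f x ^ r ∂μ) ^ (1 / r) *
      (2 ^ r * N) ^ (1 / r.conjExponent)) := by
    refine (h𝒬.levelSum_mean_le_aux hμ hμ' hf hr).trans ?_
    gcongr
    refine (ENNReal.lintegral_mul_le_Lp_mul_Lq μ hc hf.aemeasurable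
      (hm.pow_const (r - 1)).aemeasurable).trans ?_
    have : 0 ≤ 1 / r.conjExponent := one_div_nonneg.2 hc.symm.pos.le
    gcongr
    refine le_trans (le_of_eq (lintegral_congr fun x => ?_))
      (h𝒬.lintegral_maxFun_rpow_le hφ hr0 μ)
    rw [← ENNReal.rpow_mul, hc.sub_one_mul_conj]
  rcases eq_or_ne N 0 with h0 | h0
  · rw [h0]; exact zero_le
  have hinv : 1 / r + 1 / r.conjExponent = 1 := by
    simpa [one_div] using hc.inv_add_inv_eq_one
  have h2 : N ^ (1 / r) ≤ geomConst (r - 1) * 2 ^ (r - 1) * (∫⁻ x, f x ^ r ∂μ) ^ (1 / r) := by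
    have hz : N ^ (1 / r.conjExponent) ≠ 0 := (ENNReal.rpow_pos (pos_iff_ne_zero.2 h0) hNt).ne'
    have hzt : N ^ (1 / r.conjExponent) ≠ ∞ :=
      ENNReal.rpow_ne_top_of_nonneg (one_div_nonneg.2 hc.symm.pos.le) hNt
    rw [← ENNReal.mul_le_mul_iff_left hz hzt, ← ENNReal.rpow_add _ _ h0 hNt, hinv,
      ENNReal.rpow_one]
    refine h1.trans (le_of_eq ?_)
    rw [ENNReal.mul_rpow_of_nonneg _ _ (one_div_nonneg.2 hc.symm.pos.le), ← ENNReal.rpow_mul]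
    have : r * (1 / r.conjExponent) = r - 1 := by
      field_simp at hinv ⊢
      linarith
    rw [this]
    ring
  have h3 := ENNReal.rpow_le_rpow h2 hr0.le
  rwa [← ENNReal.rpow_mul, one_div_mul_cancel hr0.ne', ENNReal.rpow_one,
    ENNReal.mul_rpow_of_nonneg _ _ hr0.le, ← ENNReal.rpow_mul, one_div_mul_cancel hr0.ne',
    ENNReal.rpow_one] at h3

end MaximalFunction

section TreeOperators

/-- The function `(∑_{R ∈ 𝒬} c_R ^ q 1_R) ^ (1 / q)`. -/
noncomputable def treeSum {X : Type*} (q : ℝ) (𝒬 : Finset (Set X)) (c : Set X → ℝ≥0∞) (x : X) :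
    ℝ≥0∞ :=
  (∑ R ∈ 𝒬, R.indicator (fun _ => c R ^ q) x) ^ (1 / q)

open Classical in
/-- The `ℓ ^ q` norm of `c` along the members of `𝒬` containing `Q`. -/
noncomputable def chainNorm {X : Type*} (q : ℝ) (𝒬 : Finset (Set X)) (c : Set X → ℝ≥0∞)
    (Q : Set X) : ℝ≥0∞ :=
  (∑ R ∈ 𝒬 with Q ⊆ R, c R ^ q) ^ (1 / q)

open Classical in
/-- The maximal function of `ψ` over the members of `𝒬` all of whose strict ancestors satisfy
`φ ≤ t`. -/
noncomputable def stageMax {X : Type*} (𝒬 : Finset (Set X)) (φ ψ : Set X → ℝ≥0∞) (t : ℝ≥0∞) :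
    X → ℝ≥0∞ :=
  maxFun (𝒬.filter fun Q => ∀ R ∈ 𝒬, Q ⊂ R → φ R ≤ t) ψ

variable {X : Type*} {𝒬 : Finset (Set X)} {φ ψ c : Set X → ℝ≥0∞} {s t : ℝ≥0∞} {x : X}
  {Q R : Set X} {q : ℝ}

lemma maxFun_le_of_forall {M : ℝ≥0∞} (h : ∀ R ∈ 𝒬, x ∈ R → φ R ≤ M) : maxFun 𝒬 φ x ≤ M := by
  refine Finset.sup_le fun R hR => ?_
  by_cases hx : x ∈ R
  · simpa [hx] using h R hR hx
  · simp [hx]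

lemma stageMax_mono (𝒬 : Finset (Set X)) (φ ψ : Set X → ℝ≥0∞) (x : X) :
    Monotone fun t => stageMax 𝒬 φ ψ t x := by
  classical
  intro s t hst
  refine maxFun_le_of_forall fun R hR hx => le_maxFun ?_ hx
  rw [Finset.mem_filter] at hR ⊢
  exact ⟨hR.1, fun S hS h => (hR.2 S hS h).trans hst⟩

lemma stageMax_le_maxFun : stageMax 𝒬 φ ψ t x ≤ maxFun 𝒬 ψ x := by
  classical
  exact maxFun_le_of_forall fun _ hR hx => le_maxFun (Finset.mem_of_mem_filter _ hR) hx

lemma le_stageMax (hQ : Q ∈ maxCubes 𝒬 φ t) (hx : x ∈ Q) : ψ Q ≤ stageMax 𝒬 φ ψ t x := by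
  classical
  have h := mem_maxCubes.1 hQ
  exact le_maxFun (Finset.mem_filter.2 ⟨h.1, h.2.2⟩) hx

lemma chainNorm_le_treeSum (hq : 0 < q) (hx : x ∈ Q) : chainNorm q 𝒬 c Q ≤ treeSum q 𝒬 c x := by
  classical
  unfold chainNorm treeSum
  have : 0 ≤ 1 / q := by positivity
  gcongr
  rw [Finset.sum_filter]
  gcongr with R hR
  split_ifs with h
  · simp [h hx]
  · exact zero_le

lemma treeSum_ne_top (hq : 0 < q) (hc : ∀ R ∈ 𝒬, c R ≠ ∞) : treeSum q 𝒬 c x ≠ ∞ := by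
  refine ENNReal.rpow_ne_top_of_nonneg (by positivity) (ENNReal.sum_ne_top.2 fun R hR => ?_)
  by_cases hx : x ∈ R
  · simpa [hx] using ENNReal.rpow_ne_top_of_nonneg hq.le (hc R hR)
  · simp [hx]

lemma chainNorm_ne_top (hq : 0 < q) (hc : ∀ R ∈ 𝒬, c R ≠ ∞) : chainNorm q 𝒬 c Q ≠ ∞ := by
  classical
  exact ENNReal.rpow_ne_top_of_nonneg (by positivity) (ENNReal.sum_ne_top.2 fun R hR =>
    ENNReal.rpow_ne_top_of_nonneg hq.le (hc R (Finset.mem_of_mem_filter R hR)))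

lemma treeSum_mono_of_subset {𝒮 : Finset (Set X)} (h : 𝒮 ⊆ 𝒬) (hq : 0 < q) :
    treeSum q 𝒮 c x ≤ treeSum q 𝒬 c x := by
  unfold treeSum
  have : 0 ≤ 1 / q := by positivity
  gcongr

lemma sum_mul_le_treeSum {F : Finset (Set X)} (hq : 1 < q) (b : Set X → ℝ≥0∞)
    {a : Set X → X → ℝ≥0∞} (ha : ∀ R, Function.support (a R) ⊆ R)
    (ha1 : ∑ R ∈ F, a R x ^ q.conjExponent ≤ 1) :
    ∑ R ∈ F, b R * a R x ≤ treeSum q F b x := by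
  have hq0 : 0 < q := by linarith
  have hcj := Real.HolderConjugate.conjExponent hq
  calc ∑ R ∈ F, b R * a R x = ∑ R ∈ F, R.indicator (fun _ => b R) x * a R x := by
        refine Finset.sum_congr rfl fun R _ => ?_
        by_cases hx : x ∈ R
        · simp [hx]
        · have : a R x = 0 := by
            by_contra h
            exact hx (ha R h)
          simp [this]
    _ ≤ (∑ R ∈ F, R.indicator (fun _ => b R) x ^ q) ^ (1 / q) *
          (∑ R ∈ F, a R x ^ q.conjExponent) ^ (1 / q.conjExponent) :=
        ENNReal.inner_le_Lp_mul_Lq F _ _ hcj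
    _ ≤ (∑ R ∈ F, R.indicator (fun _ => b R) x ^ q) ^ (1 / q) * 1 := by
        gcongr
        exact ENNReal.rpow_le_one ha1 (one_div_nonneg.2 hcj.symm.pos.le)
    _ = treeSum q F b x := by
        rw [mul_one, treeSum]
        congr 1
        refine Finset.sum_congr rfl fun R _ => ?_
        by_cases hx : x ∈ R <;> simp [hx, hq0]

variable [MeasurableSpace X]

lemma IsTree.measurable_stageMax (h𝒬 : IsTree 𝒬) (φ ψ : Set X → ℝ≥0∞) (t : ℝ≥0∞) :
    Measurable (stageMax 𝒬 φ ψ t) := by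
  classical
  exact (h𝒬.filter _).measurable_maxFun ψ

lemma IsTree.stageMax_le_ancestorSup (h𝒬 : IsTree 𝒬) (hQ : Q ∈ maxCubes 𝒬 φ t) (hx : x ∈ Q) :
    stageMax 𝒬 φ ψ t x ≤ ancestorSup 𝒬 ψ Q := by
  have h := mem_maxCubes.1 hQ
  classical
  refine maxFun_le_of_forall fun R hR hxR => ?_
  rw [Finset.mem_filter] at hR
  rcases h𝒬.subset_or_ssubset h.1 hR.1 hx hxR with h1 | h1
  · exact le_ancestorSup hR.1 h1
  · exact absurd (hR.2 Q h.1 h1) (not_le.2 h.2.1)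

lemma measurable_treeSum (h : ∀ R ∈ 𝒬, MeasurableSet R) (q : ℝ) (c : Set X → ℝ≥0∞) :
    Measurable (treeSum q 𝒬 c) :=
  (Finset.measurable_fun_sum _ fun R hR => measurable_const.indicator (h R hR)).pow_const _

lemma IsTree.exists_least (h𝒬 : IsTree 𝒬) (P : Set X → Prop) (h : ∃ R ∈ 𝒬, P R)
    (hP : ∀ R S, P R → P S → ¬ Disjoint R S) : ∃ R ∈ 𝒬, P R ∧ ∀ S ∈ 𝒬, P S → R ⊆ S := by
  classical
  obtain ⟨R₀, hR₀, hP₀⟩ := h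
  obtain ⟨R, -, hR⟩ := (𝒬.filter P).exists_le_minimal (Finset.mem_filter.2 ⟨hR₀, hP₀⟩)
  have hRm := Finset.mem_filter.1 hR.prop
  refine ⟨R, hRm.1, hRm.2, fun S hS hPS => ?_⟩
  rcases h𝒬.nested R hRm.1 S hS with h | h | h
  · exact h
  · exact hR.le_of_le (Finset.mem_filter.2 ⟨hS, hPS⟩) h
  · exact absurd h (hP R S hRm.2 hPS)

lemma IsTree.treeSum_eq_maxFun (h𝒬 : IsTree 𝒬) (hq : 0 < q) (c : Set X → ℝ≥0∞) (x : X) :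
    treeSum q 𝒬 c x = maxFun 𝒬 (chainNorm q 𝒬 c) x := by
  classical
  refine le_antisymm ?_ (maxFun_le_of_forall fun R _ hx => chainNorm_le_treeSum hq hx)
  by_cases h : ∃ R ∈ 𝒬, x ∈ R
  · obtain ⟨R, hR, hxR, hmin⟩ := h𝒬.exists_least (x ∈ ·) h
      (fun R S hR hS hd => disjoint_left.1 hd hR hS)
    refine le_trans ?_ (le_maxFun hR hxR)
    unfold treeSum chainNorm
    have : 0 ≤ 1 / q := by positivity
    gcongr
    rw [Finset.sum_filter]
    gcongr with S hS
    by_cases hx : x ∈ S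
    · simp [hx, hmin S hS hx]
    · simp [hx]
  · push Not at h
    have : ∑ R ∈ 𝒬, R.indicator (fun _ => c R ^ q) x = 0 :=
      Finset.sum_eq_zero fun R hR => by simp [h R hR]
    rw [treeSum, this, ENNReal.zero_rpow_of_pos (by positivity)]
    exact zero_le

lemma IsTree.sum_ssuperset_rpow_le (h𝒬 : IsTree 𝒬) (hq : 0 < q)
    (hQ : Q ∈ maxCubes 𝒬 (chainNorm q 𝒬 c) t) [DecidablePred (Q ⊂ ·)] :
    ∑ R ∈ 𝒬 with Q ⊂ R, c R ^ q ≤ t ^ q := by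
  classical
  have hQ' := mem_maxCubes.1 hQ
  by_cases h : ∃ R ∈ 𝒬, Q ⊂ R
  · obtain ⟨y, hy⟩ := h𝒬.nonempty Q hQ'.1
    obtain ⟨R, hR, hQR, hmin⟩ := h𝒬.exists_least (Q ⊂ ·) h
      (fun R S hR hS hd => disjoint_left.1 hd (hR.1 hy) (hS.1 hy))
    have h1 := ENNReal.rpow_le_rpow (hQ'.2.2 R hR hQR) hq.le
    rw [chainNorm, ← ENNReal.rpow_mul, one_div_mul_cancel hq.ne', ENNReal.rpow_one] at h1
    refine le_trans (Finset.sum_le_sum_of_subset fun S hS => ?_) h1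
    rw [Finset.mem_filter] at hS ⊢
    exact ⟨hS.1, hmin S hS.1 hS.2⟩
  · rw [Finset.filter_false_of_mem fun R hR hQR => h ⟨R, hR, hQR⟩]
    simp

lemma IsTree.le_treeSum_subtree (h𝒬 : IsTree 𝒬) (hq : 1 ≤ q)
    (hQ : Q ∈ maxCubes 𝒬 (chainNorm q 𝒬 c) t) (hx : x ∈ Q) (h : 2 * t < treeSum q 𝒬 c x)
    [DecidablePred (· ⊆ Q)] :
    t ≤ treeSum q (𝒬.filter (· ⊆ Q)) c x := by
  classical
  have hq0 : 0 < q := by linarith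
  have hQ' := mem_maxCubes.1 hQ
  by_contra hlt
  rw [not_le] at hlt
  have h1 : ∑ R ∈ 𝒬 with R ⊆ Q, R.indicator (fun _ => c R ^ q) x ≤ t ^ q := by
    have := ENNReal.rpow_le_rpow hlt.le hq0.le
    rwa [treeSum, ← ENNReal.rpow_mul, one_div_mul_cancel hq0.ne', ENNReal.rpow_one] at this
  have h2 : ∑ R ∈ 𝒬 with ¬ R ⊆ Q, R.indicator (fun _ => c R ^ q) x ≤ t ^ q := by
    refine le_trans ?_ (h𝒬.sum_ssuperset_rpow_le hq0 hQ)
    rw [Finset.sum_filter, Finset.sum_filter]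
    gcongr with R hR
    by_cases hxR : x ∈ R
    · by_cases hRQ : R ⊆ Q
      · simp [hRQ]
      · rcases h𝒬.subset_or_ssubset hR hQ'.1 hxR hx with h3 | h3
        · exact absurd h3 hRQ
        · simp [hxR, h3, hRQ]
    · simp [hxR]
  have h3 := ENNReal.rpow_lt_rpow h hq0
  rw [treeSum, ← ENNReal.rpow_mul, one_div_mul_cancel hq0.ne', ENNReal.rpow_one,
    ← Finset.sum_filter_add_sum_filter_not 𝒬 (· ⊆ Q)] at h3
  have h4 : t ^ q + t ^ q ≤ (2 * t) ^ q := by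
    rw [ENNReal.mul_rpow_of_nonneg _ _ hq0.le, ← two_mul]
    gcongr
    simpa using ENNReal.rpow_le_rpow_of_exponent_le (x := 2) (by norm_num) hq
  exact absurd (h4.trans_lt h3) (not_lt.2 (add_le_add h1 h2))

variable {σ w : Measure X} {f : X → ℝ≥0∞}

lemma IsTree.setLIntegral_le_of_not_subset (h𝒬 : IsTree 𝒬) (hσ : ∀ Q ∈ 𝒬, σ Q ≠ 0)
    (hσ' : ∀ Q ∈ 𝒬, σ Q ≠ ∞) (hf : Measurable f) (hR : R ∈ 𝒬) (hx : x ∈ R)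
    (hxs : maxFun 𝒬 φ x ≤ s) :
    ∫⁻ y in R, f y ∂σ ≤
      ∫⁻ y in R, ({y | s < maxFun 𝒬 φ y}ᶜ.indicator f y + stageMax 𝒬 φ (mean σ f) s y) ∂σ := by
  classical
  have hΩ := h𝒬.measurableSet_lt_maxFun φ s
  set Ω := {y | s < maxFun 𝒬 φ y} with hΩdef
  have hdisj := h𝒬.pairwiseDisjoint_maxCubes φ s
  set F := (maxCubes 𝒬 φ s).filter (· ⊆ R) with hF
  have hF𝒬 : ∀ Q ∈ F, Q ∈ 𝒬 := fun Q hQ => (mem_maxCubes.1 (Finset.mem_of_mem_filter Q hQ)).1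
  have hFd : (F : Set (Set X)).PairwiseDisjoint fun Q => Q :=
    hdisj.subset (Finset.coe_subset.2 (Finset.filter_subset _ _))
  have hsub : R ∩ Ω ⊆ ⋃ Q ∈ F, Q := by
    rintro y ⟨hyR, hy⟩
    obtain ⟨Q, hQ, hyQ⟩ := lt_maxFun_iff_maxCubes.1 hy
    have hQ' := mem_maxCubes.1 hQ
    rcases h𝒬.subset_or_ssubset hQ'.1 hR hyQ hyR with h | h
    · simp only [mem_iUnion]
      exact ⟨Q, Finset.mem_filter.2 ⟨hQ, h⟩, hyQ⟩
    · exact absurd (lt_maxFun_iff_maxCubes.2 ⟨Q, hQ, h.1 hx⟩) (not_lt.2 hxs)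
  have hsubR : ⋃ Q ∈ F, Q ⊆ R := iUnion₂_subset fun Q hQ => (Finset.mem_filter.1 hQ).2
  rw [lintegral_add_left (hf.indicator hΩ.compl), ← lintegral_inter_add_sdiff f R hΩ, add_comm,
    setLIntegral_indicator hΩ.compl, inter_comm Ωᶜ, ← sdiff_eq]
  refine add_le_add le_rfl ?_
  calc ∫⁻ y in R ∩ Ω, f y ∂σ ≤ ∫⁻ y in ⋃ Q ∈ F, Q, f y ∂σ := lintegral_mono_set hsub
    _ = ∑ Q ∈ F, ∫⁻ y in Q, f y ∂σ :=
        lintegral_biUnion_finset hFd (fun Q hQ => h𝒬.meas Q (hF𝒬 Q hQ)) f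
    _ ≤ ∑ Q ∈ F, ∫⁻ y in Q, stageMax 𝒬 φ (mean σ f) s y ∂σ := by
        refine Finset.sum_le_sum fun Q hQ => ?_
        rw [← mean_mul_measure (hσ Q (hF𝒬 Q hQ)) (hσ' Q (hF𝒬 Q hQ)), ← setLIntegral_const]
        exact setLIntegral_mono (h𝒬.measurable_stageMax _ _ _)
          fun y hy => le_stageMax (Finset.mem_of_mem_filter Q hQ) hy
    _ = ∫⁻ y in ⋃ Q ∈ F, Q, stageMax 𝒬 φ (mean σ f) s y ∂σ :=
        (lintegral_biUnion_finset hFd (fun Q hQ => h𝒬.meas Q (hF𝒬 Q hQ)) _).symm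
    _ ≤ _ := lintegral_mono_set hsubR

/-- A sequence norming `treeSum q F c` on a measurable set `E`. -/
lemma exists_norming_sequence {F : Finset (Set X)} (hF : ∀ R ∈ F, MeasurableSet R)
    (hc : ∀ R ∈ F, c R ≠ ∞) (hq : 1 < q) {E : Set X} (hE : MeasurableSet E) :
    ∃ a : Set X → X → ℝ≥0∞, (∀ R, Measurable (a R)) ∧ (∀ R, Function.support (a R) ⊆ E ∩ R) ∧
      (∀ R ∉ F, a R = 0) ∧ (∀ x, ∑ R ∈ F, a R x ^ q.conjExponent ≤ 1) ∧
      ∀ x ∈ E, treeSum q F c x ≤ ∑ R ∈ F, c R * a R x := by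
  classical
  have hq0 : 0 < q := by linarith
  have hq1 : 0 < q - 1 := by linarith
  have hcj := Real.HolderConjugate.conjExponent hq
  have hNm := measurable_treeSum hF q c
  set N := treeSum q F c with hN
  have hNq : ∀ x, N x ^ q = ∑ R ∈ F, R.indicator (fun _ => c R ^ q) x := fun x => by
    rw [hN, treeSum, ← ENNReal.rpow_mul, one_div_mul_cancel hq0.ne', ENNReal.rpow_one]
  have hNt : ∀ x, N x ≠ ∞ := fun x => treeSum_ne_top hq0 hc
  refine ⟨fun R => if R ∈ F then (E ∩ R).indicator fun x => c R ^ (q - 1) / N x ^ (q - 1) else 0,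
    fun R => ?_, fun R => ?_, fun R hR => if_neg hR, fun x => ?_, fun x hx => ?_⟩
  · dsimp only
    split_ifs with h
    · exact (measurable_const.div (hNm.pow_const _)).indicator (hE.inter (hF R h))
    · exact measurable_zero
  · dsimp only
    split_ifs
    · exact support_indicator_subset
    · simp
  · calc ∑ R ∈ F, (if R ∈ F then (E ∩ R).indicator (fun x => c R ^ (q - 1) / N x ^ (q - 1))
          else 0) x ^ q.conjExponent
        ≤ ∑ R ∈ F, R.indicator (fun _ => c R ^ q) x / N x ^ q := by
          gcongr with R hR
          rw [if_pos hR]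
          by_cases hx : x ∈ E ∩ R
          · rw [indicator_of_mem hx, indicator_of_mem hx.2,
              ENNReal.div_rpow_of_nonneg _ _ hcj.symm.pos.le, ← ENNReal.rpow_mul,
              ← ENNReal.rpow_mul, hcj.sub_one_mul_conj]
          · rw [indicator_of_notMem hx, ENNReal.zero_rpow_of_pos hcj.symm.pos]
            exact zero_le
      _ = (∑ R ∈ F, R.indicator (fun _ => c R ^ q) x) / N x ^ q := by
          simp_rw [div_eq_mul_inv, Finset.sum_mul]
      _ ≤ 1 := by
          rw [← hNq]
          exact ENNReal.div_self_le_one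
  · calc N x ≤ N x ^ q / N x ^ (q - 1) := by
          rcases eq_or_ne (N x) 0 with h0 | h0
          · rw [h0]; exact zero_le
          · rw [ENNReal.le_div_iff_mul_le (Or.inl (ENNReal.rpow_pos (pos_iff_ne_zero.2 h0)
              (hNt x)).ne') (Or.inl (ENNReal.rpow_ne_top_of_nonneg hq1.le (hNt x))), mul_comm,
              rpow_sub_one_mul hq.le]
      _ = ∑ R ∈ F, R.indicator (fun _ => c R ^ q) x / N x ^ (q - 1) := by
          rw [hNq]
          simp_rw [div_eq_mul_inv, Finset.sum_mul]
      _ ≤ _ := by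
          gcongr with R hR
          dsimp only
          rw [if_pos hR]
          by_cases hxR : x ∈ R
          · rw [indicator_of_mem hxR, indicator_of_mem (mem_inter hx hxR), ← mul_div_assoc,
              mul_comm (c R), rpow_sub_one_mul hq.le]
          · simp [hxR]

end TreeOperators

section AbstractTwoWeight

variable {X : Type*} {𝒬 : Finset (Set X)} {lam φ : Set X → ℝ≥0∞} {f : X → ℝ≥0∞} {p q r : ℝ}
  {A B s t : ℝ≥0∞} {x : X} {Q R E : Set X}

open Classical in
/-- A majorant of all the functions `(sup_{R ⊇ Q} ψ R * treeSum q (subtree at Q)) ^ p` on `Q`. -/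
noncomputable def principalMajorant (𝒬 : Finset (Set X)) (ψ b : Set X → ℝ≥0∞) (p q : ℝ) (x : X) :
    ℝ≥0∞ :=
  ∑' j : ℤ, ∑ P ∈ maxCubes 𝒬 ψ (2 ^ j),
    P.indicator (fun x => ((2 : ℝ≥0∞) ^ (j + 1)) ^ p * treeSum q (𝒬.filter (· ⊆ P)) b x ^ p) x

open Classical in
lemma ancestorSup_mul_rpow_le {ψ b : Set X → ℝ≥0∞} (hψ : ∀ Q ∈ 𝒬, ψ Q ≠ ∞) (hp : 0 < p)
    (hq : 0 < q) (hx : x ∈ Q) :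
    (ancestorSup 𝒬 ψ Q * treeSum q (𝒬.filter (· ⊆ Q)) b x) ^ p ≤
      principalMajorant 𝒬 ψ b p q x := by
  rcases eq_or_ne (ancestorSup 𝒬 ψ Q) 0 with h0 | h0
  · simp [h0, hp]
  have ht : ancestorSup 𝒬 ψ Q ≠ ∞ := by
    have h : ancestorSup 𝒬 ψ Q < ∞ := by
      rw [ancestorSup, Finset.sup_lt_iff (by simp)]
      exact fun R hR => (hψ R (Finset.mem_of_mem_filter R hR)).lt_top
    exact h.ne
  obtain ⟨n, hn, hn'⟩ := exists_two_zpow_lt_le h0 ht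
  obtain ⟨R, hR, hQR, hnR⟩ := lt_ancestorSup_iff.1 hn
  obtain ⟨P, hP, hRP⟩ := exists_maxCubes_superset hR hnR
  refine le_trans ?_ (ENNReal.le_tsum n)
  refine le_trans ?_ (Finset.single_le_sum (fun _ _ => zero_le) hP)
  rw [indicator_of_mem (hRP (hQR hx)), ENNReal.mul_rpow_of_nonneg _ _ hp.le]
  gcongr
  refine treeSum_mono_of_subset (fun S hS => ?_) hq
  rw [Finset.mem_filter] at hS ⊢
  exact ⟨hS.1, hS.2.trans (hQR.trans hRP)⟩

variable [MeasurableSpace X] {σ w : Measure X}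

open Classical in
/-- The testing condition for the `ℓ ^ q`-valued operator with coefficients `lam` on a finite
tree. -/
def DirectTest (𝒬 : Finset (Set X)) (lam : Set X → ℝ≥0∞) (σ w : Measure X) (p q r : ℝ)
    (A : ℝ≥0∞) : Prop :=
  ∀ Q ∈ 𝒬, ∫⁻ x in Q, treeSum q (𝒬.filter (· ⊆ Q)) (fun R => lam R * σ R) x ^ p ∂w
    ≤ A * σ Q ^ (p / r)

open Classical in
/-- The testing condition for the dual operator on a finite tree. -/
def DualTest (𝒬 : Finset (Set X)) (lam : Set X → ℝ≥0∞) (σ w : Measure X) (p q r : ℝ)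
    (B : ℝ≥0∞) : Prop :=
  ∀ Q ∈ 𝒬, ∀ a : Set X → X → ℝ≥0∞, (∀ R, Measurable (a R)) →
    (∀ R, Function.support (a R) ⊆ R) → (∀ R ∉ 𝒬, a R = 0) →
    (∀ x, ∑ R ∈ 𝒬, a R x ^ q.conjExponent ≤ 1) →
    ∫⁻ x in Q, (∑ R ∈ 𝒬 with R ⊆ Q, R.indicator (fun _ => lam R * ∫⁻ y in R, a R y ∂w) x)
      ^ r.conjExponent ∂σ ≤ B * w Q ^ (r.conjExponent / p.conjExponent)

/-- The part of `f` below the level set `{s < maxFun φ}`, together with the means of `f` that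
more than double between the stages `t` and `s`. -/
noncomputable def freshPart (𝒬 : Finset (Set X)) (φ : Set X → ℝ≥0∞) (σ : Measure X)
    (f : X → ℝ≥0∞) (t s : ℝ≥0∞) (x : X) : ℝ≥0∞ :=
  {y | s < maxFun 𝒬 φ y}ᶜ.indicator f x +
    if 2 * stageMax 𝒬 φ (mean σ f) t x < stageMax 𝒬 φ (mean σ f) s x
    then stageMax 𝒬 φ (mean σ f) s x else 0

lemma IsTree.measurable_freshPart (h𝒬 : IsTree 𝒬) (φ : Set X → ℝ≥0∞) (σ : Measure X)
    (hf : Measurable f) (t s : ℝ≥0∞) : Measurable (freshPart 𝒬 φ σ f t s) :=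
  (hf.indicator (h𝒬.measurableSet_lt_maxFun φ s).compl).add
    (Measurable.ite (measurableSet_lt ((h𝒬.measurable_stageMax _ _ _).const_mul _)
      (h𝒬.measurable_stageMax _ _ _)) (h𝒬.measurable_stageMax _ _ _) measurable_const)

open Classical in
/-- The good-`λ` estimate on a single cube. -/
lemma IsTree.mul_measure_le (h𝒬 : IsTree 𝒬) (hσ : ∀ Q ∈ 𝒬, σ Q ≠ 0) (hσ' : ∀ Q ∈ 𝒬, σ Q ≠ ∞)
    (hr : 1 < r) (hq : 1 < q)
    (hB : DualTest 𝒬 lam σ w p q r B) (hf : Measurable f)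
    (hc : ∀ R ∈ 𝒬, lam R * ∫⁻ x in R, f x ∂σ ≠ ∞)
    (hQ : Q ∈ maxCubes 𝒬 (chainNorm q 𝒬 fun R => lam R * ∫⁻ x in R, f x ∂σ) t)
    (hE : MeasurableSet E) (hEQ : E ⊆ Q)
    (hEt : ∀ x ∈ E, 2 * t < treeSum q 𝒬 (fun R => lam R * ∫⁻ x in R, f x ∂σ) x)
    (hEs : ∀ x ∈ E, treeSum q 𝒬 (fun R => lam R * ∫⁻ x in R, f x ∂σ) x ≤ s) :
    t * w E ≤
      (∫⁻ x in Q, freshPart 𝒬 (chainNorm q 𝒬 fun R => lam R * ∫⁻ x in R, f x ∂σ) σ f t s x ^ r ∂σ)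
          ^ (1 / r) * (B * w Q ^ (r.conjExponent / p.conjExponent)) ^ (1 / r.conjExponent) +
        2 * ancestorSup 𝒬 (mean σ f) Q *
          ∫⁻ x in E, treeSum q (𝒬.filter (· ⊆ Q)) (fun R => lam R * σ R) x ∂w := by
  set c : Set X → ℝ≥0∞ := fun R => lam R * ∫⁻ x in R, f x ∂σ with hcdef
  set φ := chainNorm q 𝒬 c with hφ
  set F := 𝒬.filter (· ⊆ Q) with hF
  set m := ancestorSup 𝒬 (mean σ f) Q with hm
  set h := freshPart 𝒬 φ σ f t s with hh
  have hq0 : 0 < q := by linarith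
  have hF𝒬 : ∀ R ∈ F, R ∈ 𝒬 := fun R hR => Finset.mem_of_mem_filter R hR
  have hFQ : ∀ R ∈ F, R ⊆ Q := fun R hR => (Finset.mem_filter.1 hR).2
  have hFm : ∀ R ∈ F, MeasurableSet R := fun R hR => h𝒬.meas R (hF𝒬 R hR)
  have hhm : Measurable h := h𝒬.measurable_freshPart φ σ hf t s
  obtain ⟨a, ham, hasupp, haF, ha1, haN⟩ :=
    exists_norming_sequence hFm (fun R hR => hc R (hF𝒬 R hR)) hq hE
  have hasupp' : ∀ R, Function.support (a R) ⊆ R := fun R => (hasupp R).trans inter_subset_right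
  set α : Set X → ℝ≥0∞ := fun R => ∫⁻ y in R, a R y ∂w with hα
  have hα' : ∀ R, ∫⁻ y in E, a R y ∂w ≤ α R := fun R => by
    have h1 : ∫⁻ y in R, a R y ∂w = ∫⁻ y, a R y ∂w :=
      setLIntegral_eq_of_support_subset (hasupp' R)
    rw [hα]
    dsimp only
    rw [h1]
    exact setLIntegral_le_lintegral _ _
  have hα'' : ∀ R, α R ≤ ∫⁻ y in E, a R y ∂w := fun R => by
    have h1 : ∫⁻ y in E, a R y ∂w = ∫⁻ y, a R y ∂w :=
      setLIntegral_eq_of_support_subset ((hasupp R).trans inter_subset_left)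
    rw [h1]
    exact setLIntegral_le_lintegral _ _
  have hFsum : ∀ g : Set X → ℝ≥0∞, (∀ R ∉ F, g R = 0) → ∑ R ∈ 𝒬, g R = ∑ R ∈ F, g R :=
    fun g hg => (Finset.sum_subset (Finset.filter_subset _ _) fun R _ hR => hg R hR).symm
  have hB' := hB Q (mem_maxCubes.1 hQ).1 a ham hasupp' (fun R hR => haF R fun h => hR (hF𝒬 R h))
    fun x => by
      rw [hFsum _ fun R hR => ?_]
      · exact ha1 x
      · rw [haF R hR, Pi.zero_apply, ENNReal.zero_rpow_of_pos
          (Real.HolderConjugate.conjExponent hq).symm.pos]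
  set u : X → ℝ≥0∞ := fun x => ∑ R ∈ F, R.indicator (fun _ => lam R * α R) x with hu
  have hum : Measurable u :=
    Finset.measurable_fun_sum _ fun R hR => measurable_const.indicator (hFm R hR)
  have key : ∀ R ∈ F, c R * α R ≤ lam R * α R * ∫⁻ x in R, h x ∂σ + 2 * m * (lam R * σ R * α R) := by
    intro R hR
    rcases eq_or_ne (α R) 0 with h0 | h0
    · simp [h0]
    obtain ⟨y, hyE, hyR⟩ : ∃ y ∈ E, y ∈ R := by
      by_contra hne
      push Not at hne
      have : a R = 0 := by
        ext y
        by_contra hy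
        exact hne y (hasupp R hy).1 (hasupp R hy).2
      exact h0 (by simp [hα, this])
    have hys : maxFun 𝒬 φ y ≤ s := by
      rw [hφ, ← h𝒬.treeSum_eq_maxFun hq0]
      exact hEs y hyE
    have h1 : ∫⁻ x in R, f x ∂σ ≤ ∫⁻ x in R, h x ∂σ + 2 * m * σ R := by
      refine (h𝒬.setLIntegral_le_of_not_subset hσ hσ' hf (hF𝒬 R hR) hyR hys).trans ?_
      rw [← setLIntegral_const, ← lintegral_add_left hhm]
      refine setLIntegral_mono (hhm.add measurable_const) fun x hx => ?_
      have h2 : stageMax 𝒬 φ (mean σ f) t x ≤ m :=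
        h𝒬.stageMax_le_ancestorSup hQ (hFQ R hR hx)
      rw [hh, freshPart, add_assoc]
      gcongr
      split_ifs with hlt
      · exact le_self_add
      · rw [zero_add]
        exact (not_lt.1 hlt).trans (by gcongr)
    calc c R * α R ≤ lam R * (∫⁻ x in R, h x ∂σ + 2 * m * σ R) * α R := by
          rw [hcdef]
          dsimp only
          gcongr
      _ = _ := by ring
  calc t * w E = ∫⁻ _ in E, t ∂w := (setLIntegral_const _ _).symm
    _ ≤ ∫⁻ x in E, ∑ R ∈ F, c R * a R x ∂w := by
        refine setLIntegral_mono
          (Finset.measurable_fun_sum _ fun R _ => (ham R).const_mul _) fun x hx => ?_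
        exact (h𝒬.le_treeSum_subtree hq.le hQ (hEQ hx) (hEt x hx)).trans (haN x hx)
    _ = ∑ R ∈ F, c R * ∫⁻ x in E, a R x ∂w := by
        rw [lintegral_finsetSum _ fun R _ => (ham R).const_mul _]
        exact Finset.sum_congr rfl fun R _ => lintegral_const_mul _ (ham R)
    _ ≤ ∑ R ∈ F, (lam R * α R * ∫⁻ x in R, h x ∂σ + 2 * m * (lam R * σ R * α R)) := by
        refine Finset.sum_le_sum fun R hR => le_trans ?_ (key R hR)
        gcongr
        exact hα' R
    _ = ∑ R ∈ F, lam R * α R * ∫⁻ x in R, h x ∂σ + 2 * m * ∑ R ∈ F, lam R * σ R * α R := by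
        rw [Finset.sum_add_distrib, Finset.mul_sum]
    _ ≤ _ := by
        refine add_le_add ?_ (mul_le_mul_right ?_ _)
        · calc ∑ R ∈ F, lam R * α R * ∫⁻ x in R, h x ∂σ
              = ∫⁻ x in Q, h x * u x ∂σ := by
                rw [hu]
                have h3 : ∀ (R : Set X) (x : X), h x * R.indicator (fun _ => lam R * α R) x
                    = R.indicator (fun x => lam R * α R * h x) x := fun R x => by
                  by_cases hx : x ∈ R <;> simp [hx, mul_comm]
                simp_rw [Finset.mul_sum, h3]
                rw [lintegral_finsetSum _ fun R hR => (hhm.const_mul _).indicator (hFm R hR)]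
                refine Finset.sum_congr rfl fun R hR => ?_
                rw [setLIntegral_indicator (hFm R hR), inter_eq_left.2 (hFQ R hR),
                  lintegral_const_mul _ hhm]
            _ ≤ (∫⁻ x in Q, h x ^ r ∂σ) ^ (1 / r) *
                  (∫⁻ x in Q, u x ^ r.conjExponent ∂σ) ^ (1 / r.conjExponent) :=
                ENNReal.lintegral_mul_le_Lp_mul_Lq _ (Real.HolderConjugate.conjExponent hr)
                  hhm.aemeasurable hum.aemeasurable
            _ ≤ _ := by
                have := (Real.HolderConjugate.conjExponent hr).symm.pos
                gcongr
        · calc ∑ R ∈ F, lam R * σ R * α R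
              ≤ ∑ R ∈ F, lam R * σ R * ∫⁻ y in E, a R y ∂w := by
                gcongr with R hR
                exact hα'' R
            _ = ∫⁻ y in E, ∑ R ∈ F, lam R * σ R * a R y ∂w := by
                rw [lintegral_finsetSum _ fun R _ => (ham R).const_mul _]
                exact Finset.sum_congr rfl fun R _ => (lintegral_const_mul _ (ham R)).symm
            _ ≤ _ := lintegral_mono fun x => sum_mul_le_treeSum hq _ hasupp' (ha1 x)

lemma sum_rpow_le_rpow_sum {ι : Type*} (F : Finset ι) (x : ι → ℝ≥0∞) {s : ℝ} (hs : 1 ≤ s) :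
    ∑ i ∈ F, x i ^ s ≤ (∑ i ∈ F, x i) ^ s := by
  rw [← Finset.tsum_subtype, ← Finset.tsum_subtype]
  exact tsum_rpow_le_rpow_tsum _ hs

/-- The constant in the estimate for the sum of the fresh parts. -/
noncomputable def freshConst (r : ℝ) : ℝ≥0∞ := 2 ^ (r - 1) * (2 + 4 * (2 ^ r * maxConst r))

lemma freshConst_ne_top (hr : 1 < r) : freshConst r ≠ ∞ := by
  have h1 : (2 : ℝ≥0∞) ^ (r - 1) ≠ ∞ := ENNReal.rpow_ne_top_of_nonneg (by linarith) (by simp)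
  have h2 : (2 : ℝ≥0∞) ^ r ≠ ∞ := ENNReal.rpow_ne_top_of_nonneg (by linarith) (by simp)
  refine ENNReal.mul_ne_top h1 (ENNReal.add_ne_top.2 ⟨by simp, ENNReal.mul_ne_top (by simp) ?_⟩)
  exact ENNReal.mul_ne_top h2 (maxConst_ne_top hr)

lemma tsum_freshPart_rpow_le (hr : 1 ≤ r) (hφ : ∀ Q ∈ 𝒬, mean σ f Q ≠ ∞) (x : X) :
    ∑' k : ℤ, {x | 2 ^ k < maxFun 𝒬 φ x}.indicator
        (fun x => freshPart 𝒬 φ σ f (2 ^ k) (2 ^ (k + 2)) x ^ r) x ≤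
      2 ^ (r - 1) * (2 * f x ^ r + 4 * maxFun 𝒬 (mean σ f) x ^ r) := by
  have hr0 : 0 < r := by linarith
  have hM : maxFun 𝒬 (mean σ f) x ≠ ∞ := by
    have h : maxFun 𝒬 (mean σ f) x < ∞ := by
      rw [maxFun, Finset.sup_lt_iff (by simp)]
      intro R hR
      by_cases hx : x ∈ R <;> simp [hx, (hφ R hR).lt_top]
    exact h.ne
  calc ∑' k : ℤ, {x | 2 ^ k < maxFun 𝒬 φ x}.indicator
        (fun x => freshPart 𝒬 φ σ f (2 ^ k) (2 ^ (k + 2)) x ^ r) x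
      ≤ ∑' k : ℤ, 2 ^ (r - 1) * ((if (2 : ℝ≥0∞) ^ k < maxFun 𝒬 φ x ∧ maxFun 𝒬 φ x ≤ 2 ^ (k + 2)
            then f x ^ r else 0) +
          (if 2 * stageMax 𝒬 φ (mean σ f) (2 ^ k) x < stageMax 𝒬 φ (mean σ f) (2 ^ (k + 2)) x
            then stageMax 𝒬 φ (mean σ f) (2 ^ (k + 2)) x else 0) ^ r) := by
        refine ENNReal.tsum_le_tsum fun k => ?_
        by_cases hx : (2 : ℝ≥0∞) ^ k < maxFun 𝒬 φ x
        · rw [indicator_of_mem (by exact hx), freshPart]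
          refine (ENNReal.rpow_add_le_mul_rpow_add_rpow _ _ hr).trans ?_
          gcongr
          by_cases hx' : (2 : ℝ≥0∞) ^ (k + 2) < maxFun 𝒬 φ x
          · simp [hx', hr0]
          · simp [hx, not_lt.1 hx']
        · rw [indicator_of_notMem (by exact hx)]
          exact zero_le
    _ ≤ _ := by
        rw [ENNReal.tsum_mul_left, ENNReal.tsum_add]
        gcongr
        · exact tsum_two_zpow_window_le _ _
        · exact tsum_doubling_le (β := fun k : ℤ => stageMax 𝒬 φ (mean σ f) (2 ^ k) x)
            (fun i j h => stageMax_mono 𝒬 φ (mean σ f) x (two_zpow_mono h)) hM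
            (fun k => stageMax_le_maxFun) hr

lemma IsTree.tsum_sum_freshPart_le (h𝒬 : IsTree 𝒬) (hσ : ∀ Q ∈ 𝒬, σ Q ≠ 0)
    (hσ' : ∀ Q ∈ 𝒬, σ Q ≠ ∞) (hf : Measurable f) (hr : 1 < r) (hrp : r ≤ p)
    (hfr : ∫⁻ x, f x ^ r ∂σ ≠ ∞) :
    ∑' k : ℤ, ∑ Q ∈ maxCubes 𝒬 φ (2 ^ k),
        (∫⁻ x in Q, freshPart 𝒬 φ σ f (2 ^ k) (2 ^ (k + 2)) x ^ r ∂σ) ^ (p / r) ≤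
      (freshConst r * ∫⁻ x, f x ^ r ∂σ) ^ (p / r) := by
  have hr0 : 0 < r := by linarith
  have hpr : 1 ≤ p / r := (one_le_div hr0).2 hrp
  have hφ : ∀ Q ∈ 𝒬, mean σ f Q ≠ ∞ := fun Q hQ =>
    mean_ne_top (hσ Q hQ) (hσ' Q hQ) hf.aemeasurable hr hfr
  have hm := fun k : ℤ =>
    (h𝒬.measurable_freshPart φ σ hf (2 ^ k) (2 ^ (k + 2))).pow_const r
  have hMm := h𝒬.measurable_maxFun (mean σ f)
  calc ∑' k : ℤ, ∑ Q ∈ maxCubes 𝒬 φ (2 ^ k),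
        (∫⁻ x in Q, freshPart 𝒬 φ σ f (2 ^ k) (2 ^ (k + 2)) x ^ r ∂σ) ^ (p / r)
      ≤ ∑' k : ℤ, (∫⁻ x in {x | 2 ^ k < maxFun 𝒬 φ x},
          freshPart 𝒬 φ σ f (2 ^ k) (2 ^ (k + 2)) x ^ r ∂σ) ^ (p / r) := by
        refine ENNReal.tsum_le_tsum fun k => (sum_rpow_le_rpow_sum _ _ hpr).trans ?_
        rw [h𝒬.sum_setLIntegral_maxCubes]
    _ ≤ (∑' k : ℤ, ∫⁻ x in {x | 2 ^ k < maxFun 𝒬 φ x},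
          freshPart 𝒬 φ σ f (2 ^ k) (2 ^ (k + 2)) x ^ r ∂σ) ^ (p / r) :=
        tsum_rpow_le_rpow_tsum _ hpr
    _ ≤ _ := by
        refine ENNReal.rpow_le_rpow ?_ (by linarith)
        calc ∑' k : ℤ, ∫⁻ x in {x | 2 ^ k < maxFun 𝒬 φ x},
              freshPart 𝒬 φ σ f (2 ^ k) (2 ^ (k + 2)) x ^ r ∂σ
            = ∫⁻ x, ∑' k : ℤ, {x | 2 ^ k < maxFun 𝒬 φ x}.indicator
                (fun x => freshPart 𝒬 φ σ f (2 ^ k) (2 ^ (k + 2)) x ^ r) x ∂σ := by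
              rw [lintegral_tsum fun k =>
                ((hm k).indicator (h𝒬.measurableSet_lt_maxFun φ _)).aemeasurable]
              exact tsum_congr fun k => (lintegral_indicator (h𝒬.measurableSet_lt_maxFun φ _) _).symm
          _ ≤ ∫⁻ x, 2 ^ (r - 1) * (2 * f x ^ r + 4 * maxFun 𝒬 (mean σ f) x ^ r) ∂σ :=
              lintegral_mono fun x => tsum_freshPart_rpow_le hr.le hφ x
          _ = 2 ^ (r - 1) * (2 * ∫⁻ x, f x ^ r ∂σ + 4 * ∫⁻ x, maxFun 𝒬 (mean σ f) x ^ r ∂σ) := by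
              rw [lintegral_const_mul _ (by fun_prop), lintegral_add_left ((hf.pow_const r).const_mul 2),
                lintegral_const_mul _ (hf.pow_const r), lintegral_const_mul _ (hMm.pow_const r)]
          _ ≤ 2 ^ (r - 1) * (2 * ∫⁻ x, f x ^ r ∂σ +
                4 * (2 ^ r * (maxConst r * ∫⁻ x, f x ^ r ∂σ))) := by
              gcongr
              refine (h𝒬.lintegral_maxFun_rpow_le hφ hr0 σ).trans ?_
              gcongr
              exact h𝒬.levelSum_mean_le hσ hσ' hf hr hfr
          _ = freshConst r * ∫⁻ x, f x ^ r ∂σ := by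
              rw [freshConst]
              ring

open Classical in
lemma IsTree.measurable_principalMajorant (h𝒬 : IsTree 𝒬) (ψ b : Set X → ℝ≥0∞) (p q : ℝ) :
    Measurable (principalMajorant 𝒬 ψ b p q) :=
  Measurable.tsum fun _ => Finset.measurable_fun_sum _ fun P hP =>
    (((measurable_treeSum (h𝒬.filter (· ⊆ P)).meas q b).pow_const p).const_mul _).indicator
      (h𝒬.meas P (mem_maxCubes.1 hP).1)

lemma IsTree.lintegral_principalMajorant_le (h𝒬 : IsTree 𝒬)
    (hA : DirectTest 𝒬 lam σ w p q r A) (hr : 1 < r) (hrp : r ≤ p) (ψ : Set X → ℝ≥0∞) :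
    ∫⁻ x, principalMajorant 𝒬 ψ (fun R => lam R * σ R) p q x ∂w ≤
      A * (2 ^ r * levelSum 𝒬 ψ r σ) ^ (p / r) := by
  classical
  have hr0 : 0 < r := by linarith
  have hp0 : 0 < p := by linarith
  have hpr : 1 ≤ p / r := (one_le_div hr0).2 hrp
  have hTm := fun P : Set X =>
    (measurable_treeSum (h𝒬.filter (· ⊆ P)).meas q (fun R => lam R * σ R)).pow_const p
  have h𝒬m := fun (j : ℤ) (P : Set X) (hP : P ∈ maxCubes 𝒬 ψ (2 ^ j)) =>
    h𝒬.meas P (mem_maxCubes.1 hP).1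
  calc ∫⁻ x, principalMajorant 𝒬 ψ (fun R => lam R * σ R) p q x ∂w
      = ∑' j : ℤ, ∑ P ∈ maxCubes 𝒬 ψ (2 ^ j), ((2 : ℝ≥0∞) ^ (j + 1)) ^ p *
          ∫⁻ x in P, treeSum q (𝒬.filter (· ⊆ P)) (fun R => lam R * σ R) x ^ p ∂w := by
        unfold principalMajorant
        rw [lintegral_tsum fun j => (Finset.measurable_fun_sum _ fun P hP =>
          ((hTm P).const_mul _).indicator (h𝒬m j P hP)).aemeasurable]
        refine tsum_congr fun j => ?_
        rw [lintegral_finsetSum _ fun P hP => ((hTm P).const_mul _).indicator (h𝒬m j P hP)]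
        refine Finset.sum_congr rfl fun P hP => ?_
        rw [lintegral_indicator (h𝒬m j P hP), lintegral_const_mul _ (hTm P)]
    _ ≤ ∑' j : ℤ, ∑ P ∈ maxCubes 𝒬 ψ (2 ^ j),
          A * (((2 : ℝ≥0∞) ^ (j + 1)) ^ r * σ P) ^ (p / r) := by
        refine ENNReal.tsum_le_tsum fun j => Finset.sum_le_sum fun P hP => ?_
        rw [ENNReal.mul_rpow_of_nonneg _ _ (by linarith), ← ENNReal.rpow_mul _ r,
          mul_div_cancel₀ _ hr0.ne', mul_left_comm]
        gcongr
        exact hA P (mem_maxCubes.1 hP).1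
    _ ≤ ∑' j : ℤ, A * (((2 : ℝ≥0∞) ^ (j + 1)) ^ r * σ {x | 2 ^ j < maxFun 𝒬 ψ x}) ^ (p / r) := by
        refine ENNReal.tsum_le_tsum fun j => ?_
        rw [← Finset.mul_sum, ← h𝒬.sum_measure_maxCubes]
        refine mul_le_mul_right ?_ _
        rw [Finset.mul_sum]
        exact sum_rpow_le_rpow_sum _ _ hpr
    _ ≤ A * (∑' j : ℤ, ((2 : ℝ≥0∞) ^ (j + 1)) ^ r * σ {x | 2 ^ j < maxFun 𝒬 ψ x}) ^ (p / r) := by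
        rw [ENNReal.tsum_mul_left]
        gcongr
        exact tsum_rpow_le_rpow_tsum _ hpr
    _ = _ := by
        rw [levelSum, ← ENNReal.tsum_mul_left]
        congr 3
        ext j
        rw [two_zpow_succ, ENNReal.mul_rpow_of_nonneg _ _ hr0.le, mul_assoc]

/-- The proportion below which a level set is absorbed. -/
noncomputable def absorbRatio (p : ℝ) : ℝ≥0∞ := (2 * (4 ^ p * geomConst p))⁻¹

/-- The constant in the two-weight inequality on finite trees. -/
noncomputable def twoWeightConst (p r : ℝ) : ℝ≥0∞ :=
  2 * (4 ^ p * (2 ^ (p - 1) * ((absorbRatio p)⁻¹ ^ (p - 1) * freshConst r ^ (p / r) +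
    2 ^ p * (2 * (2 ^ r * maxConst r) ^ (p / r)))))

lemma absorbRatio_ne_zero (hp : 0 < p) : absorbRatio p ≠ 0 :=
  ENNReal.inv_ne_zero.2 (ENNReal.mul_ne_top (by simp) (ENNReal.mul_ne_top
    (ENNReal.rpow_ne_top_of_nonneg hp.le (by simp)) (geomConst_ne_top hp)))

lemma absorbRatio_ne_top : absorbRatio p ≠ ∞ := by
  have : (4 : ℝ≥0∞) ^ p ≠ 0 := (ENNReal.rpow_pos (by norm_num) (by simp)).ne'
  simp [absorbRatio, geomConst_ne_zero, this]

lemma twoWeightConst_ne_top (hr : 1 < r) (hrp : r ≤ p) : twoWeightConst p r ≠ ∞ := by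
  have hp : 0 < p := by linarith
  have hpr : 0 ≤ p / r := div_nonneg hp.le (by linarith)
  have h2 : ∀ {a : ℝ}, 0 ≤ a → (2 : ℝ≥0∞) ^ a ≠ ∞ :=
    fun h => ENNReal.rpow_ne_top_of_nonneg h (by simp)
  refine ENNReal.mul_ne_top (by simp) (ENNReal.mul_ne_top
    (ENNReal.rpow_ne_top_of_nonneg hp.le (by simp)) (ENNReal.mul_ne_top (h2 (by linarith))
    (ENNReal.add_ne_top.2 ⟨ENNReal.mul_ne_top ?_ ?_, ENNReal.mul_ne_top (h2 hp.le)
    (ENNReal.mul_ne_top (by simp) ?_)⟩)))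
  · exact ENNReal.rpow_ne_top_of_nonneg (by linarith)
      (ENNReal.inv_ne_top.2 (absorbRatio_ne_zero hp))
  · exact ENNReal.rpow_ne_top_of_nonneg hpr (freshConst_ne_top hr)
  · exact ENNReal.rpow_ne_top_of_nonneg hpr
      (ENNReal.mul_ne_top (h2 (by linarith)) (maxConst_ne_top hr))

lemma setLIntegral_rpow_le (hp : 1 < p) {g : X → ℝ≥0∞} (hg : Measurable g) (E : Set X) :
    (∫⁻ x in E, g x ∂w) ^ p ≤ (∫⁻ x in E, g x ^ p ∂w) * w E ^ (p - 1) := by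
  have hp0 : 0 < p := by linarith
  have hc := Real.HolderConjugate.conjExponent hp
  have h := ENNReal.lintegral_mul_le_Lp_mul_Lq (w.restrict E) hc
    hg.aemeasurable (aemeasurable_const (b := (1 : ℝ≥0∞)))
  simp only [Pi.mul_apply, mul_one, ENNReal.one_rpow, lintegral_one,
    Measure.restrict_apply_univ] at h
  have h' := ENNReal.rpow_le_rpow h hp0.le
  rw [ENNReal.mul_rpow_of_nonneg _ _ hp0.le, ← ENNReal.rpow_mul, ← ENNReal.rpow_mul,
    one_div_mul_cancel hp0.ne', ENNReal.rpow_one] at h'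
  convert h' using 3
  rw [one_div, inv_mul_eq_div, hc.div_conj_eq_sub_one]

/-- The two-weight inequality for positive `ℓ ^ q`-valued operators on a finite tree. -/
theorem IsTree.two_weight (h𝒬 : IsTree 𝒬) (hσ : ∀ Q ∈ 𝒬, σ Q ≠ 0) (hσ' : ∀ Q ∈ 𝒬, σ Q ≠ ∞)
    (hw' : ∀ Q ∈ 𝒬, w Q ≠ ∞) (hlam : ∀ Q ∈ 𝒬, lam Q ≠ ∞) (hr : 1 < r) (hrp : r ≤ p) (hq : 1 < q)
    (hA : DirectTest 𝒬 lam σ w p q r A) (hB : DualTest 𝒬 lam σ w p q r B) (hf : Measurable f)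
    (hfr : ∫⁻ x, f x ^ r ∂σ ≠ ∞) :
    ∫⁻ x, treeSum q 𝒬 (fun R => lam R * ∫⁻ x in R, f x ∂σ) x ^ p ∂w ≤
      twoWeightConst p r * (B ^ (p / r.conjExponent) + A) * (∫⁻ x, f x ^ r ∂σ) ^ (p / r) := by
  classical
  have hr0 : 0 < r := by linarith
  have hp1 : 1 < p := by linarith
  have hp0 : 0 < p := by linarith
  have hq0 : 0 < q := by linarith
  have hpr : 0 ≤ p / r := div_nonneg hp0.le hr0.le
  have hrc := Real.HolderConjugate.conjExponent hr
  have hpc := Real.HolderConjugate.conjExponent hp1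
  have hmean : ∀ Q ∈ 𝒬, mean σ f Q ≠ ∞ := fun Q hQ =>
    mean_ne_top (hσ Q hQ) (hσ' Q hQ) hf.aemeasurable hr hfr
  have hc : ∀ R ∈ 𝒬, lam R * ∫⁻ x in R, f x ∂σ ≠ ∞ := fun R hR => by
    rw [← mean_mul_measure (hσ R hR) (hσ' R hR)]
    exact ENNReal.mul_ne_top (hlam R hR) (ENNReal.mul_ne_top (hmean R hR) (hσ' R hR))
  set c : Set X → ℝ≥0∞ := fun R => lam R * ∫⁻ x in R, f x ∂σ with hcdef
  set φ := chainNorm q 𝒬 c with hφ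
  have hφt : ∀ Q ∈ 𝒬, φ Q ≠ ∞ := fun Q _ => chainNorm_ne_top hq0 hc
  have hTm : Measurable (treeSum q 𝒬 c) := measurable_treeSum h𝒬.meas q c
  have hTφ : ∀ x, treeSum q 𝒬 c x = maxFun 𝒬 φ x := h𝒬.treeSum_eq_maxFun hq0 c
  have hTt : ∀ x, treeSum q 𝒬 c x ≠ ∞ := fun x => treeSum_ne_top hq0 hc
  set I := ∫⁻ x, treeSum q 𝒬 c x ^ p ∂w with hI
  have hIφ : I = ∫⁻ x, maxFun 𝒬 φ x ^ p ∂w := lintegral_congr fun x => by rw [hTφ]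
  have hIt : I ≠ ∞ := by
    rw [hIφ]
    refine ne_top_of_le_ne_top ?_ (lintegral_mono fun x => maxFun_rpow_le_sum hp0)
    rw [lintegral_finsetSum _ fun R hR => measurable_const.indicator (h𝒬.meas R hR)]
    refine ENNReal.sum_ne_top.2 fun R hR => ?_
    rw [lintegral_indicator_const (h𝒬.meas R hR)]
    exact ENNReal.mul_ne_top (ENNReal.rpow_ne_top_of_nonneg hp0.le (hφt R hR)) (hw' R hR)
  set F := ∫⁻ x, f x ^ r ∂σ with hF
  set ε := absorbRatio p with hε
  set Θ := principalMajorant 𝒬 (mean σ f) (fun R => lam R * σ R) p q with hΘ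
  have hΘm : Measurable Θ := h𝒬.measurable_principalMajorant _ _ _ _
  set E : ℤ → Set X := fun k => {x | 2 ^ (k + 1) < treeSum q 𝒬 c x ∧
    treeSum q 𝒬 c x ≤ 2 ^ (k + 2)} with hE
  have hEm : ∀ k, MeasurableSet (E k) := fun k =>
    (measurableSet_lt measurable_const hTm).inter (measurableSet_le hTm measurable_const)
  have hEsub : ∀ k, E k ⊆ ⋃ Q ∈ maxCubes 𝒬 φ (2 ^ k), E k ∩ Q := fun k x hx => by
    have : 2 ^ k < maxFun 𝒬 φ x := by
      rw [← hTφ]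
      exact (two_zpow_mono (by omega)).trans_lt hx.1
    obtain ⟨Q, hQ, hxQ⟩ := lt_maxFun_iff_maxCubes.1 this
    simp only [mem_iUnion]
    exact ⟨Q, hQ, hx, hxQ⟩
  set H : ℤ → Set X → ℝ≥0∞ := fun k Q =>
    ∫⁻ x in Q, freshPart 𝒬 φ σ f (2 ^ k) (2 ^ (k + 2)) x ^ r ∂σ with hH
  have hlocal : ∀ k, ∀ Q ∈ maxCubes 𝒬 φ (2 ^ k), ((2 : ℝ≥0∞) ^ k) ^ p * w (E k ∩ Q) ≤
      ε * (((2 : ℝ≥0∞) ^ k) ^ p * w Q) + 2 ^ (p - 1) * (ε⁻¹ ^ (p - 1) *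
        (B ^ (p / r.conjExponent) * H k Q ^ (p / r)) + 2 ^ p * ∫⁻ x in E k ∩ Q, Θ x ∂w) := by
    intro k Q hQ
    have hQ𝒬 := (mem_maxCubes.1 hQ).1
    have hTQm := measurable_treeSum (h𝒬.filter (· ⊆ Q)).meas q (fun R => lam R * σ R)
    refine rpow_mul_le_of_mul_le_add hp1.le
      (ne_top_of_le_ne_top (hw' Q hQ𝒬) (measure_mono inter_subset_right)) (absorbRatio_ne_zero hp0)
      absorbRatio_ne_top
      (h𝒬.mul_measure_le hσ hσ' hr hq hB hf hc hQ ((hEm k).inter (h𝒬.meas Q hQ𝒬))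
        inter_subset_right (fun x hx => ?_) (fun x hx => hx.1.2)) ?_ ?_
    · rw [← two_zpow_succ]
      exact hx.1.1
    · rw [ENNReal.mul_rpow_of_nonneg _ _ hp0.le, ← ENNReal.rpow_mul, ← ENNReal.rpow_mul,
        one_div_mul_eq_div, one_div_mul_eq_div, ENNReal.mul_rpow_of_nonneg _ _
        (div_nonneg hp0.le hrc.symm.pos.le), ← ENNReal.rpow_mul]
      have : r.conjExponent / p.conjExponent * (p / r.conjExponent) = p - 1 := by
        rw [← hpc.div_conj_eq_sub_one]
        have := hrc.symm.pos.ne'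
        field_simp
      rw [this]
      exact le_of_eq (by ring)
    · rw [mul_assoc, ENNReal.mul_rpow_of_nonneg _ _ hp0.le, mul_assoc]
      refine mul_le_mul_right ?_ _
      rw [← lintegral_const_mul _ hTQm]
      refine (setLIntegral_rpow_le hp1 (hTQm.const_mul _) _).trans ?_
      gcongr ?_ * _
      exact setLIntegral_mono hΘm fun x hx => ancestorSup_mul_rpow_le hmean hp0 hq0 hx.2
  have hsumH : ∑' k : ℤ, ∑ Q ∈ maxCubes 𝒬 φ (2 ^ k), H k Q ^ (p / r) ≤
      (freshConst r * F) ^ (p / r) := h𝒬.tsum_sum_freshPart_le hσ hσ' hf hr hrp hfr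
  have hsumW : ∑' k : ℤ, ∑ Q ∈ maxCubes 𝒬 φ (2 ^ k), ((2 : ℝ≥0∞) ^ k) ^ p * w Q ≤
      geomConst p * I := by
    rw [hIφ]
    refine le_trans (le_of_eq (tsum_congr fun k => ?_)) (h𝒬.levelSum_le φ hp0 w)
    rw [← Finset.mul_sum, h𝒬.sum_measure_maxCubes]
  have hsumΘ : ∑' k : ℤ, ∑ Q ∈ maxCubes 𝒬 φ (2 ^ k), ∫⁻ x in E k ∩ Q, Θ x ∂w ≤
      2 * (A * (2 ^ r * (maxConst r * F)) ^ (p / r)) := by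
    calc ∑' k : ℤ, ∑ Q ∈ maxCubes 𝒬 φ (2 ^ k), ∫⁻ x in E k ∩ Q, Θ x ∂w
        ≤ ∑' k : ℤ, ∫⁻ x in E k, Θ x ∂w := by
          refine ENNReal.tsum_le_tsum fun k => ?_
          rw [← lintegral_biUnion_finset (t := fun Q => E k ∩ Q) (fun Q hQ R hR hne =>
            ((h𝒬.pairwiseDisjoint_maxCubes φ _ hQ hR hne).mono
              inter_subset_right inter_subset_right))
            (fun Q hQ => (hEm k).inter (h𝒬.meas Q (mem_maxCubes.1 hQ).1))]
          exact lintegral_mono_set (iUnion₂_subset fun Q _ => inter_subset_left)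
      _ = ∫⁻ x, ∑' k : ℤ, (E k).indicator Θ x ∂w := by
          rw [lintegral_tsum fun k => (hΘm.indicator (hEm k)).aemeasurable]
          exact tsum_congr fun k => (lintegral_indicator (hEm k) _).symm
      _ ≤ ∫⁻ x, 2 * Θ x ∂w := by
          refine lintegral_mono fun x => le_trans (ENNReal.tsum_le_tsum fun k => ?_)
            (tsum_two_zpow_window_le (treeSum q 𝒬 c x) (Θ x))
          by_cases hx : x ∈ E k
          · rw [indicator_of_mem hx, if_pos ⟨(two_zpow_mono (by omega)).trans_lt hx.1, hx.2⟩]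
          · rw [indicator_of_notMem hx]
            exact zero_le
      _ = 2 * ∫⁻ x, Θ x ∂w := lintegral_const_mul _ hΘm
      _ ≤ _ := by
          gcongr
          refine (h𝒬.lintegral_principalMajorant_le hA hr hrp _).trans ?_
          gcongr
          exact h𝒬.levelSum_mean_le hσ hσ' hf hr hfr
  have hmain : I ≤ I / 2 + 4 ^ p * (2 ^ (p - 1) * (ε⁻¹ ^ (p - 1) *
      (B ^ (p / r.conjExponent) * (freshConst r * F) ^ (p / r)) +
      2 ^ p * (2 * (A * (2 ^ r * (maxConst r * F)) ^ (p / r))))) := by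
    calc I ≤ ∫⁻ x, ∑' k : ℤ, (E k).indicator (fun _ => ((2 : ℝ≥0∞) ^ (k + 2)) ^ p) x ∂w := by
          refine lintegral_mono fun x => (rpow_le_tsum_two_zpow_window (hTt x) hp0).trans ?_
          refine le_of_eq (tsum_congr fun k => ?_)
          simp [hE, indicator]
      _ = ∑' k : ℤ, ((2 : ℝ≥0∞) ^ (k + 2)) ^ p * w (E k) := by
          rw [lintegral_tsum fun k => (measurable_const.indicator (hEm k)).aemeasurable]
          exact tsum_congr fun k => lintegral_indicator_const (hEm k) _
      _ ≤ ∑' k : ℤ, 4 ^ p * ∑ Q ∈ maxCubes 𝒬 φ (2 ^ k), ((2 : ℝ≥0∞) ^ k) ^ p * w (E k ∩ Q) := by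
          refine ENNReal.tsum_le_tsum fun k => ?_
          rw [show k + 2 = k + 1 + 1 by ring, two_zpow_succ, two_zpow_succ, ← mul_assoc,
            ENNReal.mul_rpow_of_nonneg _ _ hp0.le, ← Finset.mul_sum, mul_assoc,
            show (2 : ℝ≥0∞) * 2 = 4 by norm_num]
          gcongr
          exact (measure_mono (hEsub k)).trans (measure_biUnion_finset_le _ _)
      _ ≤ ∑' k : ℤ, 4 ^ p * ∑ Q ∈ maxCubes 𝒬 φ (2 ^ k), (ε * (((2 : ℝ≥0∞) ^ k) ^ p * w Q) +
            2 ^ (p - 1) * (ε⁻¹ ^ (p - 1) * (B ^ (p / r.conjExponent) * H k Q ^ (p / r)) +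
              2 ^ p * ∫⁻ x in E k ∩ Q, Θ x ∂w)) := by
          gcongr with k Q hQ
          exact hlocal k Q hQ
      _ = 4 ^ p * (ε * ∑' k : ℤ, ∑ Q ∈ maxCubes 𝒬 φ (2 ^ k), ((2 : ℝ≥0∞) ^ k) ^ p * w Q +
            2 ^ (p - 1) * (ε⁻¹ ^ (p - 1) * (B ^ (p / r.conjExponent) *
              ∑' k : ℤ, ∑ Q ∈ maxCubes 𝒬 φ (2 ^ k), H k Q ^ (p / r)) +
              2 ^ p * ∑' k : ℤ, ∑ Q ∈ maxCubes 𝒬 φ (2 ^ k), ∫⁻ x in E k ∩ Q, Θ x ∂w)) := by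
          simp only [Finset.sum_add_distrib, ← Finset.mul_sum, ENNReal.tsum_add,
            ENNReal.tsum_mul_left]
      _ ≤ 4 ^ p * (ε * (geomConst p * I) +
            2 ^ (p - 1) * (ε⁻¹ ^ (p - 1) * (B ^ (p / r.conjExponent) *
              (freshConst r * F) ^ (p / r)) +
              2 ^ p * (2 * (A * (2 ^ r * (maxConst r * F)) ^ (p / r))))) := by
          gcongr
      _ = _ := by
          rw [mul_add]
          congr 1
          have h0 : (4 : ℝ≥0∞) ^ p * geomConst p ≠ 0 :=
            mul_ne_zero (ENNReal.rpow_pos (by norm_num) (by simp)).ne' (geomConst_ne_zero p)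
          have ht : (4 : ℝ≥0∞) ^ p * geomConst p ≠ ∞ :=
            ENNReal.mul_ne_top (ENNReal.rpow_ne_top_of_nonneg hp0.le (by simp))
              (geomConst_ne_top hp0)
          calc (4 : ℝ≥0∞) ^ p * (ε * (geomConst p * I)) = ε * (4 ^ p * geomConst p) * I := by ring
            _ = 2⁻¹ * I := by
                rw [hε, absorbRatio, ENNReal.mul_inv (Or.inl (by simp)) (Or.inl (by simp)),
                  mul_assoc 2⁻¹, ENNReal.inv_mul_cancel h0 ht, mul_one]
            _ = I / 2 := by rw [mul_comm, div_eq_mul_inv]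
  set Y := 4 ^ p * (2 ^ (p - 1) * (ε⁻¹ ^ (p - 1) *
      (B ^ (p / r.conjExponent) * (freshConst r * F) ^ (p / r)) +
      2 ^ p * (2 * (A * (2 ^ r * (maxConst r * F)) ^ (p / r))))) with hY
  have hIY : I ≤ 2 * Y := by
    have h2 : I / 2 ≠ ∞ := ENNReal.div_ne_top hIt (by simp)
    have h1 : I / 2 ≤ Y := by
      rw [← ENNReal.add_le_add_iff_left h2, ENNReal.add_halves]
      exact hmain
    calc I = 2 * (I / 2) := (ENNReal.mul_div_cancel (by simp) (by simp)).symm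
      _ ≤ 2 * Y := by gcongr
  refine hIY.trans ?_
  rw [hY, twoWeightConst, ← mul_assoc (2 ^ r), ENNReal.mul_rpow_of_nonneg _ F hpr,
    ENNReal.mul_rpow_of_nonneg _ F hpr]
  set b := B ^ (p / r.conjExponent)
  set g := freshConst r ^ (p / r)
  set m := (2 ^ r * maxConst r) ^ (p / r)
  calc 2 * (4 ^ p * (2 ^ (p - 1) * (ε⁻¹ ^ (p - 1) * (b * (g * F ^ (p / r))) +
        2 ^ p * (2 * (A * (m * F ^ (p / r)))))))
      = 2 * (4 ^ p * (2 ^ (p - 1) * ((ε⁻¹ ^ (p - 1) * g) * b + (2 ^ p * (2 * m)) * A)))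
          * F ^ (p / r) := by ring
    _ ≤ 2 * (4 ^ p * (2 ^ (p - 1) * ((ε⁻¹ ^ (p - 1) * g + 2 ^ p * (2 * m)) * (b + A))))
          * F ^ (p / r) := by
        gcongr
        rw [add_mul, mul_add, mul_add]
        exact add_le_add le_self_add le_add_self
    _ = _ := by ring

end AbstractTwoWeight

section Cubes

variable {d : ℕ} {D : Set (Set (Fin d → ℝ))} {Q R : Set (Fin d → ℝ)} {l : ℝ}

lemma IsCube.exists_eq_pi (h : IsCube l Q) :
    ∃ a : Fin d → ℝ, Q = univ.pi fun i => Ico (a i) (a i + l) := by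
  obtain ⟨a, rfl⟩ := h
  refine ⟨a, ?_⟩
  ext x
  simp

lemma IsCube.measurableSet (h : IsCube l Q) : MeasurableSet Q := by
  obtain ⟨a, rfl⟩ := h.exists_eq_pi
  exact MeasurableSet.univ_pi fun i => measurableSet_Ico

lemma IsCube.nonempty_interior (h : IsCube l Q) (hl : 0 < l) : (interior Q).Nonempty := by
  obtain ⟨a, rfl⟩ := h.exists_eq_pi
  rw [interior_pi_set finite_univ, univ_pi_nonempty_iff]
  intro i
  rw [interior_Ico, nonempty_Ioo]
  linarith

lemma IsCube.isBounded (h : IsCube l Q) : Bornology.IsBounded Q := by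
  obtain ⟨a, rfl⟩ := h.exists_eq_pi
  exact Bornology.IsBounded.pi fun i => Metric.isBounded_Ico _ _

lemma IsCube.eq_of_subset (hQ : IsCube l Q) (hR : IsCube l R) (hl : 0 < l) (h : Q ⊆ R) :
    Q = R := by
  obtain ⟨a, rfl⟩ := hQ.exists_eq_pi
  obtain ⟨b, rfl⟩ := hR.exists_eq_pi
  have hne : (univ.pi fun i => Ico (a i) (a i + l)).Nonempty :=
    univ_pi_nonempty_iff.2 fun i => nonempty_Ico.2 (by linarith)
  have h1 : ∀ i, Ico (a i) (a i + l) ⊆ Ico (b i) (b i + l) := by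
    rcases pi_subset_pi_iff.1 h with h1 | h1
    · exact fun i => h1 i (mem_univ i)
    · exact absurd h1 hne.ne_empty
  congr 1
  ext1 i
  have h2 := (Ico_subset_Ico_iff (by linarith)).1 (h1 i)
  have : a i = b i := by linarith [h2.1, h2.2]
  rw [this]

lemma IsDyadicGrid.countable (hD : IsDyadicGrid D) : D.Countable := by
  have hsub : D ⊆ ⋃ k : ℤ, {Q ∈ D | IsCube ((2 : ℝ) ^ k) Q} := fun Q hQ => by
    obtain ⟨k, hk⟩ := hD.isCube Q hQ
    exact mem_iUnion.2 ⟨k, hQ, hk⟩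
  refine (countable_iUnion fun k => ?_).mono hsub
  have hpos : (0 : ℝ) < 2 ^ k := by positivity
  refine PairwiseDisjoint.countable_of_nonempty_interior (s := id) (fun Q hQ R hR hne => ?_)
    fun Q hQ => hQ.2.nonempty_interior hpos
  rcases hD.nested Q hQ.1 R hR.1 with h | h | h
  · exact absurd (hQ.2.eq_of_subset hR.2 hpos h) hne
  · exact absurd (hR.2.eq_of_subset hQ.2 hpos h).symm hne
  · exact h

lemma IsDyadicGrid.measurableSet (hD : IsDyadicGrid D) (hQ : Q ∈ D) : MeasurableSet Q := by
  obtain ⟨k, hk⟩ := hD.isCube Q hQ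
  exact hk.measurableSet

lemma IsDyadicGrid.nonempty_interior (hD : IsDyadicGrid D) (hQ : Q ∈ D) :
    (interior Q).Nonempty := by
  obtain ⟨k, hk⟩ := hD.isCube Q hQ
  exact hk.nonempty_interior (by positivity)

lemma IsDyadicGrid.isBounded (hD : IsDyadicGrid D) (hQ : Q ∈ D) : Bornology.IsBounded Q := by
  obtain ⟨k, hk⟩ := hD.isCube Q hQ
  exact hk.isBounded

lemma IsDyadicGrid.volume_ne_zero (hD : IsDyadicGrid D) (hQ : Q ∈ D) : volume Q ≠ 0 :=
  (Measure.measure_pos_of_nonempty_interior _ (hD.nonempty_interior hQ)).ne'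

lemma IsDyadicGrid.volume_ne_top (hD : IsDyadicGrid D) (hQ : Q ∈ D) : volume Q ≠ ∞ :=
  (hD.isBounded hQ).measure_lt_top.ne

lemma IsDyadicGrid.isTree (hD : IsDyadicGrid D) {𝒬 : Finset (Set (Fin d → ℝ))}
    (h : ∀ Q ∈ 𝒬, Q ∈ D) : IsTree 𝒬 where
  meas Q hQ := hD.measurableSet (h Q hQ)
  nonempty Q hQ := (hD.nonempty_interior (h Q hQ)).mono interior_subset
  nested Q hQ R hR := hD.nested Q (h Q hQ) R (h R hR)

end Cubes

section Weights

variable {d : ℕ} {ω f : (Fin d → ℝ) → ℝ} {Q : Set (Fin d → ℝ)}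

lemma IsWeight.aemeasurable (h : IsWeight ω) : AEMeasurable ω :=
  h.locallyIntegrable.aestronglyMeasurable.aemeasurable

lemma IsWeight.enorm_ae_eq (h : IsWeight ω) : ∀ᵐ x, ‖ω x‖ₑ = ENNReal.ofReal (ω x) := by
  filter_upwards [h.pos] with x hx
  rw [Real.enorm_eq_ofReal hx.le]

lemma wMeasure_absolutelyContinuous (ω : (Fin d → ℝ) → ℝ) : wMeasure ω ≪ volume :=
  withDensity_absolutelyContinuous _ _

lemma IsWeight.setLIntegral_enorm_mul (h : IsWeight ω) (hQ : MeasurableSet Q)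
    (hf : AEMeasurable f (wMeasure ω)) :
    ∫⁻ x in Q, ‖f x * ω x‖ₑ = ∫⁻ x in Q, ‖f x‖ₑ ∂(wMeasure ω) := by
  have hr : (wMeasure ω).restrict Q =
      (volume.restrict Q).withDensity fun x => ENNReal.ofReal (ω x) :=
    restrict_withDensity hQ _
  rw [hr, lintegral_withDensity_eq_lintegral_mul₀' h.aemeasurable.ennreal_ofReal.restrict]
  · refine lintegral_congr_ae ?_
    filter_upwards [ae_restrict_of_ae h.enorm_ae_eq] with x hx
    rw [enorm_mul, hx, Pi.mul_apply, mul_comm]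
  · rw [← hr]
    exact hf.enorm.restrict

lemma IsWeight.wMeasure_ne_top (h : IsWeight ω) (hQ : Bornology.IsBounded Q) :
    wMeasure ω Q ≠ ∞ := by
  have hc : IsCompact (closure Q) := hQ.isCompact_closure
  refine ne_top_of_le_ne_top ?_ (measure_mono subset_closure)
  rw [wMeasure, withDensity_apply _ hc.measurableSet]
  refine ne_top_of_le_ne_top (h.locallyIntegrable.integrableOn_isCompact hc).2.ne ?_
  exact lintegral_mono fun x => Real.ofReal_le_enorm _

lemma IsWeight.wMeasure_ne_zero (h : IsWeight ω) (hQ : MeasurableSet Q) (hv : volume Q ≠ 0) :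
    wMeasure ω Q ≠ 0 := by
  intro h0
  rw [wMeasure, withDensity_apply _ hQ,
    lintegral_eq_zero_iff' h.aemeasurable.ennreal_ofReal.restrict] at h0
  have h1 : ∀ᵐ _ ∂(volume.restrict Q), False := by
    filter_upwards [h0, ae_restrict_of_ae h.pos] with x hx hx'
    simp only [Pi.zero_apply, ENNReal.ofReal_eq_zero] at hx
    linarith
  rw [Filter.eventually_false_iff_eq_bot, ae_eq_bot, Measure.restrict_eq_zero] at h1
  exact hv h1

lemma enorm_avg (hv : volume Q ≠ 0) (hv' : volume Q ≠ ∞) (g : (Fin d → ℝ) → ℝ) :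
    ‖avg Q g‖ₑ = ‖∫ x in Q, g x‖ₑ / volume Q := by
  have hpos : 0 < volume.real Q := ENNReal.toReal_pos hv hv'
  rw [avg, enorm_mul, enorm_inv hpos.ne', Real.enorm_eq_ofReal hpos.le, measureReal_def,
    ENNReal.ofReal_toReal hv', mul_comm, div_eq_mul_inv]

lemma IsWeight.enorm_avg_le (h : IsWeight ω) (hQ : MeasurableSet Q) (hv : volume Q ≠ 0)
    (hv' : volume Q ≠ ∞) (hf : AEMeasurable f (wMeasure ω)) :
    ‖avg Q fun x => f x * ω x‖ₑ ≤ (∫⁻ x in Q, ‖f x‖ₑ ∂(wMeasure ω)) / volume Q := by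
  rw [enorm_avg hv hv', ← h.setLIntegral_enorm_mul hQ hf]
  gcongr
  exact enorm_integral_le_lintegral_enorm _

lemma IsWeight.aemeasurable_mul (h : IsWeight ω) (hf : AEMeasurable f (wMeasure ω)) :
    AEMeasurable (fun x => f x * ω x) := by
  obtain ⟨g, hg, hfg⟩ := hf
  refine (hg.aemeasurable.mul h.aemeasurable).congr ?_
  have h1 := (ae_withDensity_iff' h.aemeasurable.ennreal_ofReal).1 hfg
  filter_upwards [h1, h.pos] with x hx hpos
  rw [Pi.mul_apply, hx (by simpa using hpos)]

lemma IsWeight.enorm_avg_eq (h : IsWeight ω) (hQ : MeasurableSet Q) (hv : volume Q ≠ 0)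
    (hv' : volume Q ≠ ∞) (hf : AEMeasurable f (wMeasure ω)) (hf0 : ∀ x, 0 ≤ f x)
    (hfi : ∫⁻ x in Q, ‖f x‖ₑ ∂(wMeasure ω) ≠ ∞) :
    ‖avg Q fun x => f x * ω x‖ₑ = (∫⁻ x in Q, ‖f x‖ₑ ∂(wMeasure ω)) / volume Q := by
  rw [enorm_avg hv hv', ← h.setLIntegral_enorm_mul hQ hf]
  rw [← h.setLIntegral_enorm_mul hQ hf] at hfi
  congr 1
  have hnn : ∀ᵐ x ∂(volume.restrict Q), 0 ≤ f x * ω x := by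
    filter_upwards [ae_restrict_of_ae h.pos] with x hx
    exact mul_nonneg (hf0 x) hx.le
  have hi : Integrable (fun x => f x * ω x) (volume.restrict Q) :=
    ⟨(h.aemeasurable_mul hf).restrict.aestronglyMeasurable, hfi.lt_top⟩
  rw [Real.enorm_eq_ofReal (integral_nonneg_of_ae hnn),
    ofReal_integral_eq_lintegral_ofReal hi hnn]
  refine lintegral_congr_ae ?_
  filter_upwards [hnn] with x hx
  rw [Real.enorm_eq_ofReal hx]

lemma IsWeight.avg_nonneg (h : IsWeight ω) (Q : Set (Fin d → ℝ)) (hf0 : ∀ x, 0 ≤ f x) :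
    0 ≤ avg Q fun x => f x * ω x := by
  refine mul_nonneg (by positivity) (integral_nonneg_of_ae ?_)
  filter_upwards [ae_restrict_of_ae h.pos] with x hx
  exact mul_nonneg (hf0 x) hx.le

end Weights

section MonotoneLimits

variable {X ι : Type*} [MeasurableSpace X]

lemma lintegral_tsum_rpow_le [Countable ι] {μ : Measure X} {g : ι → X → ℝ≥0∞}
    (hg : ∀ i, Measurable (g i)) {s : ℝ} (hs : 0 < s) {M : ℝ≥0∞}
    (h : ∀ F : Finset ι, ∫⁻ x, (∑ i ∈ F, g i x) ^ s ∂μ ≤ M) :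
    ∫⁻ x, (∑' i, g i x) ^ s ∂μ ≤ M := by
  have h1 : ∀ x, (∑' i, g i x) ^ s = ⨆ F : Finset ι, (∑ i ∈ F, g i x) ^ s := fun x => by
    rw [ENNReal.tsum_eq_iSup_sum]
    exact (ENNReal.orderIsoRpow s hs).map_iSup _
  simp_rw [h1]
  classical
  rw [lintegral_iSup_directed
    (fun F => ((Finset.measurable_fun_sum F fun i _ => hg i).pow_const s).aemeasurable)]
  · exact iSup_le h
  · intro F G
    refine ⟨F ∪ G, fun x => ?_, fun x => ?_⟩
    · exact ENNReal.rpow_le_rpow (Finset.sum_le_sum_of_subset Finset.subset_union_left) hs.le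
    · exact ENNReal.rpow_le_rpow (Finset.sum_le_sum_of_subset Finset.subset_union_right) hs.le

lemma rpow_neg_mul_le_iff {a b c : ℝ≥0∞} (ha : a ≠ 0) (ha' : a ≠ ∞) (s : ℝ) :
    a ^ (-s) * b ≤ c ↔ b ≤ c * a ^ s := by
  have h0 : a ^ s ≠ 0 := (ENNReal.rpow_pos (pos_iff_ne_zero.2 ha) ha').ne'
  have ht : a ^ s ≠ ∞ := by simp [ENNReal.rpow_eq_top_iff, ha, ha']
  rw [ENNReal.rpow_neg, mul_comm, ← div_eq_mul_inv,
    ENNReal.div_le_iff_le_mul (Or.inl h0) (Or.inl ht)]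

end MonotoneLimits

section Operators

variable {d : ℕ} {D 𝒬 : Set (Set (Fin d → ℝ))} {τ : 𝒬 → ℝ≥0} {σ w f : (Fin d → ℝ) → ℝ}
  {p q r : ℝ} {Q : Set (Fin d → ℝ)} {x : Fin d → ℝ} {a b : 𝒬 → (Fin d → ℝ) → ℝ}

open Classical in
/-- The coefficient `τ_R / |R|` of the integral operators. -/
noncomputable def coeff (τ : 𝒬 → ℝ≥0) (R : Set (Fin d → ℝ)) : ℝ≥0∞ :=
  if h : R ∈ 𝒬 then τ ⟨R, h⟩ / volume R else 0

lemma coeff_coe (τ : 𝒬 → ℝ≥0) (R : 𝒬) :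
    coeff τ (R : Set (Fin d → ℝ)) = τ R / volume (R : Set (Fin d → ℝ)) := by
  simp [coeff]

lemma IsDyadicGrid.coeff_ne_top (hD : IsDyadicGrid D) (h𝒬 : 𝒬 ⊆ D) (τ : 𝒬 → ℝ≥0) (R : 𝒬) :
    coeff τ (R : Set (Fin d → ℝ)) ≠ ∞ := by
  rw [coeff_coe]
  exact ENNReal.div_ne_top (by simp) (hD.volume_ne_zero (h𝒬 R.2))

lemma enorm_mul_avg_le (hD : IsDyadicGrid D) (h𝒬 : 𝒬 ⊆ D) (τ : 𝒬 → ℝ≥0) (hσ : IsWeight σ)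
    (hf : AEMeasurable f (wMeasure σ)) (R : 𝒬) :
    ‖(τ R : ℝ) * avg (R : Set (Fin d → ℝ)) fun y => f y * σ y‖ₑ ≤
      coeff τ (R : Set (Fin d → ℝ)) * ∫⁻ y in R, ‖f y‖ₑ ∂(wMeasure σ) := by
  have hR := h𝒬 R.2
  rw [enorm_mul, coeff_coe, ENNReal.mul_comm_div]
  have h1 : ‖(τ R : ℝ)‖ₑ = τ R := by simp
  rw [h1]
  gcongr
  exact hσ.enorm_avg_le (hD.measurableSet hR) (hD.volume_ne_zero hR) (hD.volume_ne_top hR) hf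

lemma enorm_mul_avg_eq (hD : IsDyadicGrid D) (h𝒬 : 𝒬 ⊆ D) (τ : 𝒬 → ℝ≥0) (hσ : IsWeight σ)
    (hf : AEMeasurable f (wMeasure σ)) (hf0 : ∀ y, 0 ≤ f y) (R : 𝒬)
    (hfi : ∫⁻ y in R, ‖f y‖ₑ ∂(wMeasure σ) ≠ ∞) :
    ‖(τ R : ℝ) * avg (R : Set (Fin d → ℝ)) fun y => f y * σ y‖ₑ =
      coeff τ (R : Set (Fin d → ℝ)) * ∫⁻ y in R, ‖f y‖ₑ ∂(wMeasure σ) := by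
  have hR := h𝒬 R.2
  rw [enorm_mul, coeff_coe, ENNReal.mul_comm_div]
  have h1 : ‖(τ R : ℝ)‖ₑ = τ R := by simp
  rw [h1, hσ.enorm_avg_eq (hD.measurableSet hR) (hD.volume_ne_zero hR) (hD.volume_ne_top hR) hf
    hf0 hfi]

lemma Tbar_eq (hq : 0 < q) : Tbar q τ σ f x = (∑' R : 𝒬, (R : Set (Fin d → ℝ)).indicator
    (fun _ => ‖(τ R : ℝ) * avg (R : Set (Fin d → ℝ)) fun y => f y * σ y‖ₑ ^ q) x) ^ (1 / q) := by
  rw [Tbar]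
  congr 1
  refine tsum_congr fun R => ?_
  by_cases hx : x ∈ (R : Set (Fin d → ℝ)) <;> simp [hx, hq]

lemma Tbar_le (hD : IsDyadicGrid D) (h𝒬 : 𝒬 ⊆ D) (hσ : IsWeight σ)
    (hf : AEMeasurable f (wMeasure σ)) (hq : 0 < q) :
    Tbar q τ σ f x ≤ (∑' R : 𝒬, (R : Set (Fin d → ℝ)).indicator (fun _ =>
      (coeff τ (R : Set (Fin d → ℝ)) * ∫⁻ y in R, ‖f y‖ₑ ∂(wMeasure σ)) ^ q) x) ^ (1 / q) := by
  rw [Tbar_eq hq]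
  refine ENNReal.rpow_le_rpow (ENNReal.tsum_le_tsum fun R => ?_) (by positivity)
  refine indicator_le_indicator ?_
  exact ENNReal.rpow_le_rpow (enorm_mul_avg_le hD h𝒬 τ hσ hf R) hq.le

lemma sum_le_Tbar (hD : IsDyadicGrid D) (h𝒬 : 𝒬 ⊆ D) (hσ : IsWeight σ)
    (hf : AEMeasurable f (wMeasure σ)) (hf0 : ∀ y, 0 ≤ f y)
    (hfi : ∀ R : 𝒬, ∫⁻ y in R, ‖f y‖ₑ ∂(wMeasure σ) ≠ ∞) (hq : 0 < q) (F : Finset 𝒬) :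
    (∑ R ∈ F, (R : Set (Fin d → ℝ)).indicator (fun _ =>
      (coeff τ (R : Set (Fin d → ℝ)) * ∫⁻ y in R, ‖f y‖ₑ ∂(wMeasure σ)) ^ q) x) ^ (1 / q) ≤
        Tbar q τ σ f x := by
  rw [Tbar_eq hq]
  refine ENNReal.rpow_le_rpow ?_ (by positivity)
  simp_rw [enorm_mul_avg_eq hD h𝒬 τ hσ hf hf0 _ (hfi _)]
  exact ENNReal.sum_le_tsum F

lemma measurable_Tbar (hD : IsDyadicGrid D) (h𝒬 : 𝒬 ⊆ D) (hq : 0 < q) :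
    Measurable (Tbar q τ σ f) := by
  have : Countable 𝒬 := (hD.countable.mono h𝒬).to_subtype
  have h1 : Tbar q τ σ f = fun x => (∑' R : 𝒬, (R : Set (Fin d → ℝ)).indicator
      (fun _ => ‖(τ R : ℝ) * avg (R : Set (Fin d → ℝ)) fun y => f y * σ y‖ₑ ^ q) x) ^ (1 / q) :=
    funext fun x => Tbar_eq hq
  rw [h1]
  exact (Measurable.tsum fun R =>
    measurable_const.indicator (hD.measurableSet (h𝒬 R.2))).pow_const _

lemma treeSum_map (F : Finset 𝒬) (c : Set (Fin d → ℝ) → ℝ≥0∞) :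
    treeSum q (F.map (Function.Embedding.subtype _)) c x =
      (∑ R ∈ F, (R : Set (Fin d → ℝ)).indicator (fun _ => c R ^ q) x) ^ (1 / q) := by
  rw [treeSum, Finset.sum_map]
  rfl

/-- The majorant of `|U|` obtained by taking absolute values inside. -/
noncomputable def majorantU (τ : 𝒬 → ℝ≥0) (w : (Fin d → ℝ) → ℝ) (Q : Set (Fin d → ℝ))
    (a : 𝒬 → (Fin d → ℝ) → ℝ) (x : Fin d → ℝ) : ℝ≥0∞ :=
  ∑' R : 𝒬, (R : Set (Fin d → ℝ)).indicator (fun _ => coeff τ (R : Set (Fin d → ℝ)) *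
    ∫⁻ y in R, ‖(Q ∩ (R : Set (Fin d → ℝ))).indicator (a R) y‖ₑ ∂(wMeasure w)) x

lemma indicator_mul_weight (S : Set (Fin d → ℝ)) (g w : (Fin d → ℝ) → ℝ) :
    (S.indicator fun y => g y * w y) = fun y => S.indicator g y * w y := by
  ext y
  by_cases hy : y ∈ S <;> simp [hy]

lemma enorm_termU (R : 𝒬) (g : (Fin d → ℝ) → ℝ) :
    ‖(R : Set (Fin d → ℝ)).indicator (fun _ => avg (R : Set (Fin d → ℝ)) g * (τ R : ℝ)) x‖ₑ =
      (R : Set (Fin d → ℝ)).indicator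
        (fun _ => ‖(τ R : ℝ) * avg (R : Set (Fin d → ℝ)) g‖ₑ) x := by
  by_cases hx : x ∈ (R : Set (Fin d → ℝ)) <;> simp [hx, mul_comm]

lemma absU_le_majorantU (hD : IsDyadicGrid D) (h𝒬 : 𝒬 ⊆ D) (hw : IsWeight w) (hQ : MeasurableSet Q)
    (ha : ∀ R, AEMeasurable (a R) volume) :
    absU τ (fun R => (Q ∩ (R : Set (Fin d → ℝ))).indicator fun y => a R y * w y) x ≤
      majorantU τ w Q a x := by
  have hle : ∑' R : 𝒬, ‖(R : Set (Fin d → ℝ)).indicator (fun _ => avg (R : Set (Fin d → ℝ))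
      ((Q ∩ (R : Set (Fin d → ℝ))).indicator fun y => a R y * w y) * (τ R : ℝ)) x‖ₑ ≤
        majorantU τ w Q a x := by
    refine ENNReal.tsum_le_tsum fun R => ?_
    rw [enorm_termU, indicator_mul_weight]
    refine indicator_le_indicator (enorm_mul_avg_le hD h𝒬 τ hw ?_ R)
    exact (((ha R).mono_ac (wMeasure_absolutelyContinuous w)).indicator
      (hQ.inter (hD.measurableSet (h𝒬 R.2))))
  rcases eq_or_ne (majorantU τ w Q a x) ∞ with htop | htop
  · rw [htop]
    exact le_top
  · have hs := Summable.of_enorm (ne_top_of_le_ne_top htop hle)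
    rw [absU, if_pos hs]
    exact (enorm_tsum_le_tsum_enorm).trans hle

lemma majorantU_le_absU (hD : IsDyadicGrid D) (h𝒬 : 𝒬 ⊆ D) (hw : IsWeight w) (hQ : MeasurableSet Q)
    (ha : ∀ R, AEMeasurable (a R) volume) (ha0 : ∀ R y, 0 ≤ a R y)
    (hfi : ∀ R : 𝒬, ∫⁻ y in R, ‖(Q ∩ (R : Set (Fin d → ℝ))).indicator (a R) y‖ₑ ∂(wMeasure w) ≠ ∞) :
    majorantU τ w Q a x ≤
      absU τ (fun R => (Q ∩ (R : Set (Fin d → ℝ))).indicator fun y => a R y * w y) x := by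
  rw [absU]
  split_ifs with hs
  · have hnn : ∀ R : 𝒬, 0 ≤ (R : Set (Fin d → ℝ)).indicator (fun _ => avg (R : Set (Fin d → ℝ))
        ((Q ∩ (R : Set (Fin d → ℝ))).indicator fun y => a R y * w y) * (τ R : ℝ)) x := fun R => by
      refine indicator_nonneg (fun _ _ => mul_nonneg ?_ (by positivity)) x
      rw [indicator_mul_weight]
      exact hw.avg_nonneg _ fun y => indicator_nonneg (fun z _ => ha0 R z) y
    rw [Real.enorm_eq_ofReal (tsum_nonneg hnn), ENNReal.ofReal_tsum_of_nonneg hnn hs]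
    refine ENNReal.tsum_le_tsum fun R => ?_
    rw [← Real.enorm_eq_ofReal (hnn R), enorm_termU, indicator_mul_weight]
    refine indicator_le_indicator (le_of_eq (enorm_mul_avg_eq hD h𝒬 τ hw ?_ ?_ R (hfi R)).symm)
    · exact (((ha R).mono_ac (wMeasure_absolutelyContinuous w)).indicator
        (hQ.inter (hD.measurableSet (h𝒬 R.2))))
    · exact fun y => indicator_nonneg (fun z _ => ha0 R z) y
  · exact le_top

lemma MemB.tsum_le_one {s : ℝ} (hs : 0 < s) (ha : MemB s a) :
    ∀ᵐ y, ∑' R : 𝒬, ‖a R y‖ₑ ^ s ≤ 1 := by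
  filter_upwards [ha.norm_eq_one] with y hy
  by_cases hmem : y ∈ ⋃₀ 𝒬
  · have h1 := congrArg (· ^ s) (hy hmem)
    simp only [← ENNReal.rpow_mul, one_div_mul_cancel hs.ne', ENNReal.rpow_one,
      ENNReal.one_rpow] at h1
    exact h1.le
  · have h0 : ∀ R : 𝒬, a R y = 0 := fun R => by
      by_contra h
      exact hmem ⟨R, R.2, ha.support_subset R h⟩
    simp [h0, hs]

lemma MemB.enorm_le_one {s : ℝ} (hs : 0 < s) (ha : MemB s a) (R : 𝒬) :
    ∀ᵐ y, ‖a R y‖ₑ ≤ 1 := by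
  filter_upwards [ha.tsum_le_one hs] with y hy
  rw [← ENNReal.rpow_le_rpow_iff hs, ENNReal.one_rpow]
  exact (ENNReal.le_tsum (f := fun R : 𝒬 => ‖a R y‖ₑ ^ s) R).trans hy

lemma setLIntegral_enorm_le_measure {μ : Measure (Fin d → ℝ)} (S : Set (Fin d → ℝ))
    {g : (Fin d → ℝ) → ℝ} (hg : ∀ᵐ y ∂μ, ‖g y‖ₑ ≤ 1) : ∫⁻ y in S, ‖g y‖ₑ ∂μ ≤ μ S := by
  calc ∫⁻ y in S, ‖g y‖ₑ ∂μ ≤ ∫⁻ _ in S, 1 ∂μ := lintegral_mono_ae (ae_restrict_of_ae hg)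
    _ = μ S := by simp

end Operators

section Necessity

variable {d : ℕ} {D 𝒬 : Set (Set (Fin d → ℝ))} {τ : 𝒬 → ℝ≥0} {σ w f : (Fin d → ℝ) → ℝ}
  {p q r : ℝ} {Q : Set (Fin d → ℝ)} {x : Fin d → ℝ} {a : 𝒬 → (Fin d → ℝ) → ℝ} {C : ℝ≥0∞}

lemma IsDyadicGrid.wMeasure_ne_zero (hD : IsDyadicGrid D) (hσ : IsWeight σ) (hQ : Q ∈ D) :
    wMeasure σ Q ≠ 0 :=
  hσ.wMeasure_ne_zero (hD.measurableSet hQ) (hD.volume_ne_zero hQ)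

lemma IsDyadicGrid.wMeasure_ne_top (hD : IsDyadicGrid D) (hσ : IsWeight σ) (hQ : Q ∈ D) :
    wMeasure σ Q ≠ ∞ :=
  hσ.wMeasure_ne_top (hD.isBounded hQ)

lemma eLpNorm_ofReal_eq {X ε : Type*} [MeasurableSpace X] [TopologicalSpace ε]
    [ContinuousENorm ε] {μ : Measure X} (hp : 0 < p) (g : X → ε) :
    eLpNorm g (ENNReal.ofReal p) μ = (∫⁻ x, ‖g x‖ₑ ^ p ∂μ) ^ (1 / p) := by
  rw [eLpNorm_eq_lintegral_rpow_enorm_toReal (by simpa using hp) (by simp),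
    ENNReal.toReal_ofReal hp.le]

lemma BoundedBy.lintegral_le (h : BoundedBy r p q τ σ w C) (hr : 0 < r) (hp : 0 < p)
    (hf : MemLp f (ENNReal.ofReal r) (wMeasure σ)) :
    ∫⁻ x, Tbar q τ σ f x ^ p ∂(wMeasure w) ≤
      C ^ p * (∫⁻ x, ‖f x‖ₑ ^ r ∂(wMeasure σ)) ^ (p / r) := by
  have h1 := ENNReal.rpow_le_rpow (h f hf) hp.le
  rw [eLpNorm_ofReal_eq hp, eLpNorm_ofReal_eq hr, ENNReal.mul_rpow_of_nonneg _ _ hp.le,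
    ← ENNReal.rpow_mul, ← ENNReal.rpow_mul, one_div_mul_cancel hp.ne', ENNReal.rpow_one,
    one_div_mul_eq_div] at h1
  simpa using h1

lemma BoundedBy.directTesting_le (hD : IsDyadicGrid D) (hσ : IsWeight σ)
    (h : BoundedBy r p q τ σ w C) (hr : 0 < r) (hp : 0 < p) :
    directTesting r p q D τ σ w ^ (1 / p) ≤ C := by
  rw [one_div, ENNReal.rpow_inv_le_iff hp]
  refine iSup₂_le fun Q hQ => ?_
  have hQm := hD.measurableSet hQ
  rw [rpow_neg_mul_le_iff (hD.wMeasure_ne_zero hσ hQ) (hD.wMeasure_ne_top hσ hQ)]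
  have hmem : MemLp (Q.indicator fun _ => (1 : ℝ)) (ENNReal.ofReal r) (wMeasure σ) :=
    memLp_indicator_const _ hQm _ (Or.inr (hD.wMeasure_ne_top hσ hQ))
  refine (setLIntegral_le_lintegral _ _).trans ((h.lintegral_le hr hp hmem).trans (le_of_eq ?_))
  congr 2
  rw [← lintegral_indicator_one hQm]
  refine lintegral_congr fun x => ?_
  by_cases hx : x ∈ Q <;> simp [hx, hr]

lemma BoundedBy.lintegral_sum_le (hD : IsDyadicGrid D) (h𝒬 : 𝒬 ⊆ D) (hσ : IsWeight σ)
    (hw : IsWeight w) (h : BoundedBy r p q τ σ w C) (hr : 1 < r) (hp : 1 < p) (hq : 1 < q)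
    (hQ : Q ∈ D) (ha : MemB q.conjExponent a) (F : Finset 𝒬) :
    ∫⁻ x in Q, (∑ R ∈ F, (R : Set (Fin d → ℝ)).indicator (fun _ =>
      coeff τ (R : Set (Fin d → ℝ)) * ∫⁻ y in R,
        ‖(Q ∩ (R : Set (Fin d → ℝ))).indicator (a R) y‖ₑ ∂(wMeasure w)) x) ^ r.conjExponent
        ∂(wMeasure σ) ≤
      C ^ r.conjExponent * wMeasure w Q ^ (r.conjExponent / p.conjExponent) := by
  have hr0 : 0 < r := by linarith
  have hp0 : 0 < p := by linarith
  have hq0 : 0 < q := by linarith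
  have hrc := Real.HolderConjugate.conjExponent hr
  have hpc := Real.HolderConjugate.conjExponent hp
  have hqc := Real.HolderConjugate.conjExponent hq
  have hQm := hD.measurableSet hQ
  have hRm : ∀ R : 𝒬, MeasurableSet (R : Set (Fin d → ℝ)) := fun R => hD.measurableSet (h𝒬 R.2)
  have ham : ∀ R, AEMeasurable (a R) (wMeasure w) := fun R =>
    (ha.aemeasurable R).mono_ac (wMeasure_absolutelyContinuous w)
  have ha1 : ∀ R, ∀ᵐ y ∂(wMeasure w), ‖a R y‖ₑ ≤ 1 := fun R =>
    (wMeasure_absolutelyContinuous w).ae_le (ha.enorm_le_one hqc.symm.pos R)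
  set α : 𝒬 → ℝ≥0∞ := fun R =>
    ∫⁻ y in R, ‖(Q ∩ (R : Set (Fin d → ℝ))).indicator (a R) y‖ₑ ∂(wMeasure w) with hα
  have hαQ : ∀ R, α R ≤ ∫⁻ y in Q, ‖a R y‖ₑ ∂(wMeasure w) := fun R => by
    calc α R ≤ ∫⁻ y, ‖(Q ∩ (R : Set (Fin d → ℝ))).indicator (a R) y‖ₑ ∂(wMeasure w) :=
          setLIntegral_le_lintegral _ _
      _ ≤ ∫⁻ y, Q.indicator (fun y => ‖a R y‖ₑ) y ∂(wMeasure w) := by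
          refine lintegral_mono fun y => ?_
          by_cases hy : y ∈ Q <;> by_cases hyR : y ∈ (R : Set (Fin d → ℝ)) <;> simp [hy, hyR]
      _ = _ := lintegral_indicator hQm _
  have hαt : ∀ R, α R ≠ ∞ := fun R => ne_top_of_le_ne_top (hD.wMeasure_ne_top hw hQ)
    ((hαQ R).trans (setLIntegral_enorm_le_measure Q (ha1 R)))
  set V : (Fin d → ℝ) → ℝ≥0∞ := fun x => ∑ R ∈ F, (R : Set (Fin d → ℝ)).indicator
    (fun _ => coeff τ (R : Set (Fin d → ℝ)) * α R) x with hV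
  set N : ℝ≥0∞ := ∑ R ∈ F, coeff τ (R : Set (Fin d → ℝ)) * α R with hN
  have hNt : N ≠ ∞ := ENNReal.sum_ne_top.2 fun R _ =>
    ENNReal.mul_ne_top (hD.coeff_ne_top h𝒬 τ R) (hαt R)
  have hVN : ∀ x, V x ≤ N := fun x => Finset.sum_le_sum fun R _ => indicator_le_self _ _ x
  have hVt : ∀ x, V x ≠ ∞ := fun x => ne_top_of_le_ne_top hNt (hVN x)
  have hVm : Measurable V :=
    Finset.measurable_fun_sum _ fun R _ => measurable_const.indicator (hRm R)
  set J := ∫⁻ x in Q, V x ^ r.conjExponent ∂(wMeasure σ) with hJ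
  have hJt : J ≠ ∞ := by
    refine ne_top_of_le_ne_top ?_ (lintegral_mono fun x =>
      ENNReal.rpow_le_rpow (hVN x) hrc.symm.pos.le)
    rw [lintegral_const, Measure.restrict_apply_univ]
    exact ENNReal.mul_ne_top (ENNReal.rpow_ne_top_of_nonneg hrc.symm.pos.le hNt)
      (hD.wMeasure_ne_top hσ hQ)
  have hr1 : 0 < r.conjExponent - 1 := hrc.symm.sub_one_pos
  set f : (Fin d → ℝ) → ℝ := Q.indicator fun x => (V x ^ (r.conjExponent - 1)).toReal with hf
  have hfm : Measurable f := ((hVm.pow_const _).ennreal_toReal).indicator hQm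
  have hf0 : ∀ x, 0 ≤ f x := fun x => indicator_nonneg (fun _ _ => ENNReal.toReal_nonneg) x
  have hfe : ∀ x, ‖f x‖ₑ = Q.indicator (fun x => V x ^ (r.conjExponent - 1)) x := fun x => by
    by_cases hx : x ∈ Q
    · rw [hf, indicator_of_mem hx, indicator_of_mem hx,
        Real.enorm_eq_ofReal ENNReal.toReal_nonneg,
        ENNReal.ofReal_toReal (ENNReal.rpow_ne_top_of_nonneg hr1.le (hVt x))]
    · simp [hf, hx]
  have hfr : ∫⁻ x, ‖f x‖ₑ ^ r ∂(wMeasure σ) = J := by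
    rw [hJ, ← lintegral_indicator hQm]
    refine lintegral_congr fun x => ?_
    rw [hfe]
    by_cases hx : x ∈ Q
    · rw [indicator_of_mem hx, indicator_of_mem hx, ← ENNReal.rpow_mul, hrc.symm.sub_one_mul_conj]
    · simp [hx, hr0]
  have hfmem : MemLp f (ENNReal.ofReal r) (wMeasure σ) := by
    refine ⟨hfm.aestronglyMeasurable, ?_⟩
    rw [eLpNorm_ofReal_eq hr0, hfr]
    exact (ENNReal.rpow_ne_top_of_nonneg (by positivity) hJt).lt_top
  have hfi : ∀ R : 𝒬, ∫⁻ y in R, ‖f y‖ₑ ∂(wMeasure σ) ≠ ∞ := fun R => by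
    have h1 := setLIntegral_rpow_le hr hfm.enorm (w := wMeasure σ) (R : Set (Fin d → ℝ))
    have h2 := ne_top_of_le_ne_top (ENNReal.mul_ne_top
      (ne_top_of_le_ne_top (hfr ▸ hJt) (setLIntegral_le_lintegral _ _))
      (ENNReal.rpow_ne_top_of_nonneg (by linarith) (hD.wMeasure_ne_top hσ (h𝒬 R.2)))) h1
    intro htop
    rw [htop, ENNReal.top_rpow_of_pos hr0] at h2
    exact h2 rfl
  set c : 𝒬 → ℝ≥0∞ := fun R =>
    coeff τ (R : Set (Fin d → ℝ)) * ∫⁻ y in R, ‖f y‖ₑ ∂(wMeasure σ) with hc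
  have hTm : Measurable (Tbar q τ σ f) := measurable_Tbar hD h𝒬 hq0
  have hJS : J ≤ ∫⁻ x in Q, Tbar q τ σ f x ∂(wMeasure w) := by
    calc J = ∑ R ∈ F, coeff τ (R : Set (Fin d → ℝ)) * α R * ∫⁻ y in R, ‖f y‖ₑ ∂(wMeasure σ) := by
          have h1 : ∀ x, Q.indicator (fun x => V x ^ r.conjExponent) x = ∑ R ∈ F,
              (R : Set (Fin d → ℝ)).indicator
                (fun x => coeff τ (R : Set (Fin d → ℝ)) * α R * ‖f x‖ₑ) x := fun x => by
            by_cases hx : x ∈ Q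
            · rw [indicator_of_mem hx, ← rpow_sub_one_mul hrc.symm.lt.le]
              nth_rewrite 2 [hV]
              rw [Finset.mul_sum]
              refine Finset.sum_congr rfl fun R _ => ?_
              by_cases hxR : x ∈ (R : Set (Fin d → ℝ)) <;> simp [hxR, hfe, hx, mul_comm]
            · rw [indicator_of_notMem hx]
              refine (Finset.sum_eq_zero fun R _ => ?_).symm
              by_cases hxR : x ∈ (R : Set (Fin d → ℝ)) <;> simp [hxR, hf, hx]
          rw [hJ, ← lintegral_indicator hQm]
          simp_rw [h1]
          rw [lintegral_finsetSum _ fun R _ => (hfm.enorm.const_mul _).indicator (hRm R)]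
          refine Finset.sum_congr rfl fun R _ => ?_
          rw [lintegral_indicator (hRm R), lintegral_const_mul _ hfm.enorm]
      _ = ∑ R ∈ F, c R * α R := Finset.sum_congr rfl fun R _ => by rw [hc]; ring
      _ ≤ ∑ R ∈ F, c R * ∫⁻ y in Q, ‖a R y‖ₑ ∂(wMeasure w) := by
          gcongr with R hR
          exact hαQ R
      _ = ∫⁻ y in Q, ∑ R ∈ F, c R * ‖a R y‖ₑ ∂(wMeasure w) := by
          rw [lintegral_finsetSum' _ fun R _ => ((ham R).enorm.const_mul _).restrict]
          exact Finset.sum_congr rfl fun R _ => (lintegral_const_mul'' _ (ham R).enorm.restrict).symm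
      _ ≤ _ := by
          refine lintegral_mono_ae (ae_restrict_of_ae ?_)
          filter_upwards [(wMeasure_absolutelyContinuous w).ae_le
            (ha.tsum_le_one hqc.symm.pos)] with y hy
          calc ∑ R ∈ F, c R * ‖a R y‖ₑ
              = ∑ R ∈ F, (R : Set (Fin d → ℝ)).indicator (fun _ => c R) y * ‖a R y‖ₑ := by
                refine Finset.sum_congr rfl fun R _ => ?_
                by_cases hyR : y ∈ (R : Set (Fin d → ℝ))
                · simp [hyR]
                · have h0 : a R y = 0 := by
                    by_contra h
                    exact hyR (ha.support_subset R h)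
                  simp [h0]
            _ ≤ (∑ R ∈ F, (R : Set (Fin d → ℝ)).indicator (fun _ => c R) y ^ q) ^ (1 / q) *
                  (∑ R ∈ F, ‖a R y‖ₑ ^ q.conjExponent) ^ (1 / q.conjExponent) :=
                ENNReal.inner_le_Lp_mul_Lq F _ _ hqc
            _ ≤ (∑ R ∈ F, (R : Set (Fin d → ℝ)).indicator (fun _ => c R) y ^ q) ^ (1 / q) * 1 := by
                gcongr
                exact ENNReal.rpow_le_one ((ENNReal.sum_le_tsum F).trans hy)
                  (one_div_nonneg.2 hqc.symm.pos.le)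
            _ = (∑ R ∈ F, (R : Set (Fin d → ℝ)).indicator (fun _ => c R ^ q) y) ^ (1 / q) := by
                rw [mul_one]
                congr 1
                refine Finset.sum_congr rfl fun R _ => ?_
                by_cases hyR : y ∈ (R : Set (Fin d → ℝ)) <;> simp [hyR, hq0]
            _ ≤ _ := sum_le_Tbar hD h𝒬 hσ hfm.aemeasurable hf0 hfi hq0 F
  have hSp : J ^ p ≤ C ^ p * J ^ (p / r) * wMeasure w Q ^ (p - 1) := by
    calc J ^ p ≤ (∫⁻ x in Q, Tbar q τ σ f x ∂(wMeasure w)) ^ p := by gcongr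
      _ ≤ (∫⁻ x in Q, Tbar q τ σ f x ^ p ∂(wMeasure w)) * wMeasure w Q ^ (p - 1) :=
          setLIntegral_rpow_le hp hTm Q
      _ ≤ _ := by
          gcongr
          refine (setLIntegral_le_lintegral _ _).trans ?_
          have h1 := h.lintegral_le hr0 hp0 hfmem
          rwa [hfr] at h1
  rcases eq_or_ne J 0 with h0 | h0
  · rw [h0]
    exact zero_le
  have hz : J ^ (p / r) ≠ 0 := (ENNReal.rpow_pos (pos_iff_ne_zero.2 h0) hJt).ne'
  have hzt : J ^ (p / r) ≠ ∞ := ENNReal.rpow_ne_top_of_nonneg (by positivity) hJt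
  have hsplit : J ^ p = J ^ (p / r.conjExponent) * J ^ (p / r) := by
    rw [← ENNReal.rpow_add _ _ h0 hJt]
    congr 1
    have := hrc.inv_add_inv_eq_one
    rw [div_eq_mul_inv, div_eq_mul_inv, ← mul_add, add_comm, this, mul_one]
  have hfin : J ^ (p / r.conjExponent) ≤ C ^ p * wMeasure w Q ^ (p - 1) := by
    rw [← ENNReal.mul_le_mul_iff_left hz hzt, ← hsplit]
    exact hSp.trans (le_of_eq (by ring))
  have hpos : 0 < r.conjExponent / p := div_pos hrc.symm.pos hp0
  have h3 := ENNReal.rpow_le_rpow hfin hpos.le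
  rw [ENNReal.mul_rpow_of_nonneg _ _ hpos.le, ← ENNReal.rpow_mul, ← ENNReal.rpow_mul,
    ← ENNReal.rpow_mul, div_mul_div_cancel₀' hp0.ne', div_self hrc.symm.pos.ne', ENNReal.rpow_one,
    mul_div_cancel₀ _ hp0.ne'] at h3
  refine h3.trans (le_of_eq ?_)
  congr 2
  rw [← hpc.div_conj_eq_sub_one]
  have := hpc.symm.pos.ne'
  field_simp

lemma BoundedBy.dualTesting_le (hD : IsDyadicGrid D) (h𝒬 : 𝒬 ⊆ D) (hσ : IsWeight σ)
    (hw : IsWeight w) (h : BoundedBy r p q τ σ w C) (hr : 1 < r) (hp : 1 < p) (hq : 1 < q) :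
    dualTesting r p q D τ σ w ^ (1 / r.conjExponent) ≤ C := by
  have hrc := Real.HolderConjugate.conjExponent hr
  have : Countable 𝒬 := (hD.countable.mono h𝒬).to_subtype
  rw [one_div, ENNReal.rpow_inv_le_iff hrc.symm.pos]
  refine iSup₂_le fun Q hQ => iSup₂_le fun a ha => ?_
  have hQm := hD.measurableSet hQ
  rw [rpow_neg_mul_le_iff (hD.wMeasure_ne_zero hw hQ) (hD.wMeasure_ne_top hw hQ)]
  refine (lintegral_mono fun x => ENNReal.rpow_le_rpow
    (absU_le_majorantU hD h𝒬 hw hQm ha.aemeasurable) hrc.symm.pos.le).trans ?_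
  exact lintegral_tsum_rpow_le
    (fun R => measurable_const.indicator (hD.measurableSet (h𝒬 R.2))) hrc.symm.pos
    fun F => h.lintegral_sum_le hD h𝒬 hσ hw hr hp hq hQ ha F

end Necessity

section Sufficiency

variable {d : ℕ} {D 𝒬 : Set (Set (Fin d → ℝ))} {τ : 𝒬 → ℝ≥0} {σ w f : (Fin d → ℝ) → ℝ}
  {p q r s : ℝ} {Q : Set (Fin d → ℝ)} {x : Fin d → ℝ}

/-- A nonnegative sequence whose `ℓ ^ s` norm is at most one is dominated by a member of `B`. -/
lemma exists_memB_ge (hD : IsDyadicGrid D) (h𝒬 : 𝒬 ⊆ D) (hs : 0 < s) (F : Finset 𝒬)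
    {a : 𝒬 → (Fin d → ℝ) → ℝ≥0∞} (ham : ∀ R, Measurable (a R))
    (hasupp : ∀ R : 𝒬, Function.support (a R) ⊆ (R : Set (Fin d → ℝ))) (haF : ∀ R ∉ F, a R = 0)
    (ha1 : ∀ x, ∑ R ∈ F, a R x ^ s ≤ 1) :
    ∃ b : 𝒬 → (Fin d → ℝ) → ℝ, MemB s b ∧ (∀ R x, 0 ≤ b R x) ∧ ∀ R x, a R x ≤ ‖b R x‖ₑ := by
  have hcount : Countable 𝒬 := (hD.countable.mono h𝒬).to_subtype
  have hRm : ∀ R : 𝒬, MeasurableSet (R : Set (Fin d → ℝ)) := fun R => hD.measurableSet (h𝒬 R.2)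
  obtain ⟨ε, hε, hε1⟩ := ENNReal.exists_pos_sum_of_countable (ε := 1) one_ne_zero 𝒬
  set i : 𝒬 → (Fin d → ℝ) → ℝ≥0∞ := fun R => (R : Set (Fin d → ℝ)).indicator fun _ => (ε R : ℝ≥0∞)
    with hi
  have him : ∀ R, Measurable (i R) := fun R => measurable_const.indicator (hRm R)
  set Z : (Fin d → ℝ) → ℝ≥0∞ := fun x => ∑' R, i R x with hZ
  have hZm : Measurable Z := Measurable.tsum him
  have hZt : ∀ x, Z x ≠ ∞ := fun x =>
    ne_top_of_le_ne_top hε1.ne_top (ENNReal.tsum_le_tsum fun R => indicator_le_self _ _ x)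
  set S : (Fin d → ℝ) → ℝ≥0∞ := fun x => ∑ R ∈ F, a R x ^ s with hS
  have hSm : Measurable S := Finset.measurable_fun_sum _ fun R _ => (ham R).pow_const s
  have hStsum : ∀ x, ∑' R, a R x ^ s = S x := fun x =>
    tsum_eq_sum fun R hR => by simp [haF R hR, hs]
  set g : 𝒬 → (Fin d → ℝ) → ℝ≥0∞ := fun R x => a R x ^ s + (1 - S x) * (i R x / Z x) with hg
  have hgm : ∀ R, Measurable (g R) := fun R =>
    ((ham R).pow_const s).add ((measurable_const.sub hSm).mul ((him R).div hZm))
  have hgt : ∀ R x, g R x ≠ ∞ := fun R x => by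
    refine ENNReal.add_ne_top.2 ⟨?_, ENNReal.mul_ne_top (by simp) ?_⟩
    · refine ne_top_of_le_ne_top ENNReal.one_ne_top (le_trans ?_ (ha1 x))
      have h1 := hStsum x
      rw [hS] at h1
      dsimp only at h1
      rw [← h1]
      exact ENNReal.le_tsum (f := fun R => a R x ^ s) R
    · exact ne_top_of_le_ne_top ENNReal.one_ne_top ((ENNReal.div_le_div_right
        (ENNReal.le_tsum (f := fun R => i R x) R) _).trans ENNReal.div_self_le_one)
  have hgsum : ∀ x ∈ ⋃₀ 𝒬, ∑' R, g R x = 1 := by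
    rintro x ⟨R, hR, hxR⟩
    have hZ0 : Z x ≠ 0 := by
      have h1 := ENNReal.le_tsum (f := fun R => i R x) ⟨R, hR⟩
      have h2 : i ⟨R, hR⟩ x = ε ⟨R, hR⟩ := by simp [hi, hxR]
      rw [h2] at h1
      exact (lt_of_lt_of_le (by exact_mod_cast hε ⟨R, hR⟩) h1).ne'
    rw [hg]
    dsimp only
    rw [ENNReal.tsum_add, hStsum, ENNReal.tsum_mul_left]
    simp_rw [div_eq_mul_inv]
    rw [ENNReal.tsum_mul_right, ENNReal.mul_inv_cancel hZ0 (hZt x), mul_one]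
    exact add_tsub_cancel_of_le (ha1 x)
  have hbe : ∀ R x, ‖(g R x ^ (1 / s)).toReal‖ₑ = g R x ^ (1 / s) := fun R x => by
    rw [Real.enorm_eq_ofReal ENNReal.toReal_nonneg,
      ENNReal.ofReal_toReal (ENNReal.rpow_ne_top_of_nonneg (by positivity) (hgt R x))]
  refine ⟨fun R x => (g R x ^ (1 / s)).toReal, ⟨fun R => ?_, ?_, fun R x hx => ?_⟩,
    fun R x => ENNReal.toReal_nonneg, fun R x => ?_⟩
  · exact ((hgm R).pow_const _).ennreal_toReal.aemeasurable
  · refine Filter.Eventually.of_forall fun x hx => ?_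
    simp_rw [hbe, ← ENNReal.rpow_mul, one_div_mul_cancel hs.ne', ENNReal.rpow_one]
    rw [hgsum x hx, ENNReal.one_rpow]
  · by_contra hxR
    have h0 : a R x = 0 := by
      by_contra h
      exact hxR (hasupp R h)
    refine hx ?_
    simp [hg, hi, h0, hxR, hs]
  · rw [hbe]
    calc a R x = (a R x ^ s) ^ (1 / s) := by
          rw [← ENNReal.rpow_mul, mul_one_div_cancel hs.ne', ENNReal.rpow_one]
      _ ≤ _ := ENNReal.rpow_le_rpow le_self_add (by positivity)

lemma directTest_of_directTesting (hD : IsDyadicGrid D) (h𝒬 : 𝒬 ⊆ D) (hσ : IsWeight σ)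
    (hp : 0 < p) (hq : 0 < q) (F : Finset 𝒬) :
    DirectTest (F.map (Function.Embedding.subtype _)) (coeff τ) (wMeasure σ) (wMeasure w) p q r
      (directTesting r p q D τ σ w) := by
  classical
  intro Q hQ
  obtain ⟨Q', -, rfl⟩ := Finset.mem_map.1 hQ
  have hQD : (Q' : Set (Fin d → ℝ)) ∈ D := h𝒬 Q'.2
  have hQm := hD.measurableSet hQD
  have h1 : wMeasure σ Q' ^ (-(p / r)) * ∫⁻ x in Q', Tbar q τ σ
      ((Q' : Set (Fin d → ℝ)).indicator fun _ => 1) x ^ p ∂(wMeasure w) ≤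
        directTesting r p q D τ σ w :=
    le_iSup₂_of_le (f := fun Q (_ : Q ∈ D) => wMeasure σ Q ^ (-(p / r)) *
      ∫⁻ x in Q, Tbar q τ σ (Q.indicator fun _ => 1) x ^ p ∂(wMeasure w)) _ hQD le_rfl
  rw [rpow_neg_mul_le_iff (hD.wMeasure_ne_zero hσ hQD) (hD.wMeasure_ne_top hσ hQD)] at h1
  refine le_trans (lintegral_mono fun x => ENNReal.rpow_le_rpow ?_ hp.le) h1
  have hind : ∀ y, ‖(Q' : Set (Fin d → ℝ)).indicator (fun _ => (1 : ℝ)) y‖ₑ =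
      (Q' : Set (Fin d → ℝ)).indicator 1 y := fun y => by
    by_cases hy : y ∈ (Q' : Set (Fin d → ℝ)) <;> simp [hy]
  refine le_trans ?_ (sum_le_Tbar hD h𝒬 hσ (measurable_const.indicator hQm).aemeasurable
    (fun y => indicator_nonneg (fun _ _ => zero_le_one) y) (fun R => ?_) hq F)
  · rw [treeSum, Finset.sum_filter, Finset.sum_map]
    refine ENNReal.rpow_le_rpow (Finset.sum_le_sum fun R _ => ?_) (by positivity)
    split_ifs with hRQ
    · refine indicator_le_indicator (ENNReal.rpow_le_rpow ?_ hq.le)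
      simp_rw [hind]
      rw [lintegral_indicator_one hQm, Measure.restrict_apply hQm]
      refine mul_le_mul_right (measure_mono ?_) _
      exact subset_inter hRQ subset_rfl
    · exact zero_le
  · refine ne_top_of_le_ne_top (hD.wMeasure_ne_top hσ (h𝒬 R.2))
      (setLIntegral_enorm_le_measure _ (Filter.Eventually.of_forall fun y => ?_))
    by_cases hy : y ∈ (Q' : Set (Fin d → ℝ)) <;> simp [hy]

lemma dualTest_of_dualTesting (hD : IsDyadicGrid D) (h𝒬 : 𝒬 ⊆ D) (hw : IsWeight w)
    (hr : 1 < r) (hq : 1 < q) (F : Finset 𝒬) :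
    DualTest (F.map (Function.Embedding.subtype _)) (coeff τ) (wMeasure σ) (wMeasure w) p q r
      (dualTesting r p q D τ σ w) := by
  classical
  intro Q hQ a ham hasupp haF ha1
  have hrc := Real.HolderConjugate.conjExponent hr
  have hqc := Real.HolderConjugate.conjExponent hq
  obtain ⟨Q', -, rfl⟩ := Finset.mem_map.1 hQ
  have hQD : (Q' : Set (Fin d → ℝ)) ∈ D := h𝒬 Q'.2
  have hQm := hD.measurableSet hQD
  obtain ⟨b, hb, hb0, hab⟩ := exists_memB_ge hD h𝒬 hqc.symm.pos F
    (a := fun R : 𝒬 => a (R : Set (Fin d → ℝ))) (fun R => ham R) (fun R => hasupp R)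
    (fun R hR => haF R fun h => hR (by simpa using h)) (fun x => by
      have := ha1 x
      rwa [Finset.sum_map] at this)
  have h1 : wMeasure w Q' ^ (-(r.conjExponent / p.conjExponent)) *
      ∫⁻ x in Q', absU τ (fun R => ((Q' : Set (Fin d → ℝ)) ∩ (R : Set (Fin d → ℝ))).indicator
        fun y => b R y * w y) x ^ r.conjExponent ∂(wMeasure σ) ≤ dualTesting r p q D τ σ w := by
    unfold dualTesting
    exact le_iSup₂_of_le (Q' : Set (Fin d → ℝ)) hQD (le_iSup₂_of_le b hb le_rfl)
  rw [rpow_neg_mul_le_iff (hD.wMeasure_ne_zero hw hQD) (hD.wMeasure_ne_top hw hQD)] at h1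
  refine le_trans (lintegral_mono fun x => ENNReal.rpow_le_rpow ?_ hrc.symm.pos.le) h1
  refine le_trans ?_ (majorantU_le_absU hD h𝒬 hw hQm hb.aemeasurable hb0 fun R => ?_)
  · rw [Finset.sum_filter, Finset.sum_map]
    refine le_trans (Finset.sum_le_sum fun R _ => ?_) (ENNReal.sum_le_tsum F)
    split_ifs with hRQ
    · refine indicator_le_indicator (mul_le_mul_right ?_ _)
      refine setLIntegral_mono' (hD.measurableSet (h𝒬 R.2)) fun y hy => ?_
      have hmem : y ∈ (Q' : Set (Fin d → ℝ)) ∩ (R : Set (Fin d → ℝ)) := ⟨hRQ hy, hy⟩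
      rw [indicator_of_mem hmem]
      exact hab R y
    · exact zero_le
  · refine ne_top_of_le_ne_top (hD.wMeasure_ne_top hw (h𝒬 R.2)) (setLIntegral_enorm_le_measure _ ?_)
    filter_upwards [(wMeasure_absolutelyContinuous w).ae_le
      (hb.enorm_le_one hqc.symm.pos R)] with y hy
    by_cases hyQR : y ∈ (Q' : Set (Fin d → ℝ)) ∩ (R : Set (Fin d → ℝ))
    · rwa [indicator_of_mem hyQR]
    · simp [indicator_of_notMem hyQR]

/-- The constant in the upper bound for the operator norm. -/
noncomputable def normConst (p r : ℝ) : ℝ≥0∞ := (2 * twoWeightConst p r) ^ (1 / p)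

lemma normConst_ne_top (hr : 1 < r) (hrp : r ≤ p) : normConst p r ≠ ∞ :=
  ENNReal.rpow_ne_top_of_nonneg (one_div_nonneg.2 (by linarith))
    (ENNReal.mul_ne_top (by simp) (twoWeightConst_ne_top hr hrp))

lemma boundedBy_normConst_mul (hD : IsDyadicGrid D) (h𝒬 : 𝒬 ⊆ D) (hσ : IsWeight σ)
    (hw : IsWeight w) (hr : 1 < r) (hrp : r ≤ p) (hq : 1 < q) :
    BoundedBy r p q τ σ w (normConst p r * max (dualTesting r p q D τ σ w ^ (1 / r.conjExponent))
      (directTesting r p q D τ σ w ^ (1 / p))) := by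
  intro f hf
  have hr0 : 0 < r := by linarith
  have hp0 : 0 < p := by linarith
  have hq0 : 0 < q := by linarith
  have hrc := Real.HolderConjugate.conjExponent hr
  have hcount : Countable 𝒬 := (hD.countable.mono h𝒬).to_subtype
  set L := dualTesting r p q D τ σ w
  set A := directTesting r p q D τ σ w
  set M := max (L ^ (1 / r.conjExponent)) (A ^ (1 / p)) with hM
  have hfm := hf.aestronglyMeasurable.aemeasurable
  set N := ∫⁻ x, ‖f x‖ₑ ^ r ∂(wMeasure σ) with hN
  have hNt : N ≠ ∞ := by
    have h1 := hf.eLpNorm_ne_top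
    rw [eLpNorm_ofReal_eq hr0] at h1
    intro htop
    rw [← hN, htop, ENNReal.top_rpow_of_pos (by positivity)] at h1
    exact h1 rfl
  obtain ⟨g, hgm, hfg⟩ := hfm.enorm
  have hgN : ∫⁻ x, g x ^ r ∂(wMeasure σ) = N :=
    lintegral_congr_ae (by filter_upwards [hfg] with x hx; rw [hx])
  have hgR : ∀ S : Set (Fin d → ℝ), ∫⁻ x in S, ‖f x‖ₑ ∂(wMeasure σ) =
      ∫⁻ x in S, g x ∂(wMeasure σ) := fun S => lintegral_congr_ae (ae_restrict_of_ae hfg)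
  have hLM : L ^ (p / r.conjExponent) ≤ M ^ p := by
    rw [← one_div_mul_eq_div, ENNReal.rpow_mul]
    exact ENNReal.rpow_le_rpow (le_max_left _ _) hp0.le
  have hAM : A ≤ M ^ p := by
    calc A = (A ^ (1 / p)) ^ p := by
          rw [← ENNReal.rpow_mul, one_div_mul_cancel hp0.ne', ENNReal.rpow_one]
      _ ≤ M ^ p := ENNReal.rpow_le_rpow (le_max_right _ _) hp0.le
  have hfinite : ∀ F : Finset 𝒬, ∫⁻ x, (∑ R ∈ F, (R : Set (Fin d → ℝ)).indicator (fun _ =>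
      (coeff τ (R : Set (Fin d → ℝ)) * ∫⁻ y in R, ‖f y‖ₑ ∂(wMeasure σ)) ^ q) x) ^ (p / q)
        ∂(wMeasure w) ≤ 2 * twoWeightConst p r * M ^ p * N ^ (p / r) := by
    intro F
    set G := F.map (Function.Embedding.subtype _) with hG
    have hGD : ∀ R ∈ G, R ∈ D := fun R hR => by
      obtain ⟨R', -, rfl⟩ := Finset.mem_map.1 hR
      exact h𝒬 R'.2
    have h1 := (hD.isTree hGD).two_weight
      (fun R hR => hD.wMeasure_ne_zero hσ (hGD R hR)) (fun R hR => hD.wMeasure_ne_top hσ (hGD R hR))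
      (fun R hR => hD.wMeasure_ne_top hw (hGD R hR))
      (fun R hR => by
        obtain ⟨R', -, rfl⟩ := Finset.mem_map.1 hR
        exact hD.coeff_ne_top h𝒬 τ R')
      hr hrp hq (directTest_of_directTesting (τ := τ) (w := w) (r := r) hD h𝒬 hσ hp0 hq0 F)
      (dualTest_of_dualTesting (τ := τ) (σ := σ) (p := p) hD h𝒬 hw hr hq F) hgm (hgN ▸ hNt)
    rw [hgN] at h1
    calc _ = ∫⁻ x, treeSum q G (fun R => coeff τ R * ∫⁻ y in R, g y ∂(wMeasure σ)) x ^ p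
            ∂(wMeasure w) := by
          refine lintegral_congr fun x => ?_
          rw [treeSum_map, ← ENNReal.rpow_mul, one_div_mul_eq_div]
          simp_rw [hgR]
      _ ≤ twoWeightConst p r * (L ^ (p / r.conjExponent) + A) * N ^ (p / r) := h1
      _ ≤ twoWeightConst p r * (M ^ p + M ^ p) * N ^ (p / r) := by gcongr
      _ = _ := by ring
  have hT : ∫⁻ x, Tbar q τ σ f x ^ p ∂(wMeasure w) ≤
      2 * twoWeightConst p r * M ^ p * N ^ (p / r) := by
    refine le_trans (lintegral_mono fun x => ?_) (lintegral_tsum_rpow_le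
      (fun R : 𝒬 => measurable_const.indicator (hD.measurableSet (h𝒬 R.2))) (div_pos hp0 hq0)
      hfinite)
    refine (ENNReal.rpow_le_rpow (Tbar_le hD h𝒬 hσ hfm hq0) hp0.le).trans (le_of_eq ?_)
    rw [← ENNReal.rpow_mul, one_div_mul_eq_div]
  rw [eLpNorm_ofReal_eq hp0, eLpNorm_ofReal_eq hr0]
  have h2 := ENNReal.rpow_le_rpow hT (one_div_nonneg.2 hp0.le)
  rw [ENNReal.mul_rpow_of_nonneg _ _ (one_div_nonneg.2 hp0.le),
    ENNReal.mul_rpow_of_nonneg _ _ (one_div_nonneg.2 hp0.le), ← ENNReal.rpow_mul M,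
    mul_one_div_cancel hp0.ne', ENNReal.rpow_one, ← ENNReal.rpow_mul N] at h2
  have h3 : p / r * (1 / p) = 1 / r := by field_simp
  rw [h3] at h2
  simpa [normConst] using h2

end Sufficiency

end VectorDyadic

theorem theorem1 (d : ℕ) (r p q : ℝ) (hr : 1 < r) (hrp : r ≤ p) (hq : 1 < q) :
    ∃ K : NNReal, 0 < K ∧
      ∀ (D : Set (Set (Fin d → ℝ))), VectorDyadic.IsDyadicGrid D →
      ∀ (𝒬 : Set (Set (Fin d → ℝ))), 𝒬 ⊆ D →
      ∀ (τ : 𝒬 → NNReal) (σ w : (Fin d → ℝ) → ℝ),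
        VectorDyadic.IsWeight σ → VectorDyadic.IsWeight w →
        (VectorDyadic.IsBoundedOp r p q τ σ w ↔
          VectorDyadic.dualTesting r p q D τ σ w < ∞ ∧
          VectorDyadic.directTesting r p q D τ σ w < ∞) ∧
        VectorDyadic.opNorm r p q τ σ w ≤
          K * max (VectorDyadic.dualTesting r p q D τ σ w ^ (1 / r.conjExponent))
            (VectorDyadic.directTesting r p q D τ σ w ^ (1 / p)) ∧
        max (VectorDyadic.dualTesting r p q D τ σ w ^ (1 / r.conjExponent))
            (VectorDyadic.directTesting r p q D τ σ w ^ (1 / p)) ≤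
          K * VectorDyadic.opNorm r p q τ σ w := by
  have hp : 1 < p := by linarith
  have hp0 : 0 < p := by linarith
  have hrc := Real.HolderConjugate.conjExponent hr
  have hNt := VectorDyadic.normConst_ne_top hr hrp
  have hN : VectorDyadic.normConst p r ≤ ((max 1 (VectorDyadic.normConst p r).toNNReal : ℝ≥0)) := by
    calc VectorDyadic.normConst p r = ((VectorDyadic.normConst p r).toNNReal : ℝ≥0∞) :=
          (ENNReal.coe_toNNReal hNt).symm
      _ ≤ _ := ENNReal.coe_le_coe.2 (le_max_right _ _)
  refine ⟨max 1 (VectorDyadic.normConst p r).toNNReal, lt_max_of_lt_left one_pos,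
    fun D hD 𝒬 h𝒬 τ σ w hσ hw => ?_⟩
  have hupper := VectorDyadic.boundedBy_normConst_mul (τ := τ) hD h𝒬 hσ hw hr hrp hq
  have hlower : ∀ C, VectorDyadic.BoundedBy r p q τ σ w C →
      max (VectorDyadic.dualTesting r p q D τ σ w ^ (1 / r.conjExponent))
        (VectorDyadic.directTesting r p q D τ σ w ^ (1 / p)) ≤ C := fun C hC =>
    max_le (hC.dualTesting_le hD h𝒬 hσ hw hr hp hq) (hC.directTesting_le hD hσ (by linarith) hp0)
  refine ⟨⟨fun ⟨C, hC⟩ => ?_, fun ⟨h1, h2⟩ => ?_⟩, ?_, ?_⟩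
  · have h := (hlower C hC).trans_lt ENNReal.coe_lt_top
    rw [max_lt_iff] at h
    exact ⟨(ENNReal.rpow_lt_top_iff_of_pos (one_div_pos.2 hrc.symm.pos)).1 h.1,
      (ENNReal.rpow_lt_top_iff_of_pos (one_div_pos.2 hp0)).1 h.2⟩
  · set C := VectorDyadic.normConst p r *
      max (VectorDyadic.dualTesting r p q D τ σ w ^ (1 / r.conjExponent))
        (VectorDyadic.directTesting r p q D τ σ w ^ (1 / p)) with hC
    have hCt : C ≠ ∞ := ENNReal.mul_ne_top hNt (max_lt
      ((ENNReal.rpow_lt_top_iff_of_pos (one_div_pos.2 hrc.symm.pos)).2 h1)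
      ((ENNReal.rpow_lt_top_iff_of_pos (one_div_pos.2 hp0)).2 h2)).ne
    exact ⟨C.toNNReal, by rwa [ENNReal.coe_toNNReal hCt]⟩
  · exact (sInf_le hupper).trans (mul_le_mul_left hN _)
  · calc _ ≤ VectorDyadic.opNorm r p q τ σ w := le_sInf fun C hC => hlower C hC
      _ ≤ _ := le_mul_of_one_le_left zero_le (by exact_mod_cast le_max_left _ _)
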